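/- Let $\Gamma\subset\mathbb R^2$ be a finite metric graph embedded in the plane with straight edges: finitely many vertices, finitely many edges $e_j$ ($j\in J$) of lengths $l_{e_j}\in(0,+\infty]$, no isolated vertices, and an interior point of an edge lies on no other edge. Each edge is $\{p_j+x\,u_j:\ 0\le x\le l_{e_j}\}$ ($x<\infty$), where $p_j$ is a vertex and $u_j$ a unit vector (an edge of finite length also ends at a vertex). Let $(x_j,y_j)$ be the Cartesian coordinates of $\mathbb R^2$ with origin $p_j$, $x_j$ along $u_j$ and $y_j$ orthogonal to it. Let $d_\Gamma(q)=\inf_{\tilde q\in\Gamma}|q-\tilde q|$ and, for $\varepsilon>0$, let $$\widehat H(\varepsilon)=-\tfrac12\Delta+\tfrac{1}{2\varepsilon^2}d_\Gamma^2$$ be the self-adjoint operator on $L^2(\mathbb R^2)$ associated with the quadratic form $\tfrac12\|\nabla\psi\|^2+\tfrac1{2\varepsilon^2}\|d_\Gamma\psi\|^2$ with form domain $\{\psi\in H^1(\mathbb R^2): d_\Gamma\psi\in L^2(\mathbb R^2)\}$. Let $\Phi_n^\varepsilon$ be the $n$-th normalized eigenfunction ($n\ge 0$) of the harmonic oscillator,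 $\big(-\tfrac12\partial_y^2+\tfrac1{2\varepsilon^2}y^2\big)\Phi_n^\varepsilon=\tfrac{E_n}{\varepsilon}\Phi_n^\varepsilon$, $E_n=n+\tfrac12$. Fix $j_0\in J$, $n\ge 0$, $f\in C_0^\infty((0,l_{e_{j_0}}))$ and $T>0$. Put $\widetilde H(\varepsilon)=\widehat H(\varepsilon)-E_n/\varepsilon$, $\psi_0(x_{j_0},y_{j_0})=f(x_{j_0})\Phi_n^\varepsilon(y_{j_0})$ and $\psi_t^\varepsilon=\exp(-it\widetilde H(\varepsilon))\psi_0$, where $\exp(-it\widetilde H(\varepsilon))$ is the strongly continuous unitary group generated by $-i\widetilde H(\varepsilon)$ (which exists for every $\varepsilon>0$), and for $j\in J$ $$s_j^n(t,x_j;\varepsilon)=\int_{\mathbb R}\overline{\Phi_n^\varepsilon(y_j)}\,\psi_t^\varepsilon(x_j,y_j)\,dy_j .$$ Then every sequence of positive $\varepsilon$ tending to $0$ has a subsequence along which, for every $j\in J$, $s_j^n(\cdot,\cdot;\varepsilon)$ converges in the weak$^*$ topology of $L^\infty((0,T),L^2(\mathbb R))$ to some $s_j^n(\cdot,\cdot;0)\in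 L^\infty((0,T),L^2(\mathbb R))$, and the limit satisfies $$i\,\partial_t s_j^n(t,x_j;0)=-\tfrac12\,\partial_{x_j}^2 s_j^n(t,x_j;0)\quad\text{in }\mathcal D'\big((0,T)\times(0,l_{e_j})\big).$$ -/

import Mathlib

open MeasureTheory Set Filter Topology
open scoped ENNReal ContDiff SchwartzMap LineDeriv ComplexConjugate

noncomputable section

/-- The Euclidean plane. -/
abbrev Plane : Type := EuclideanSpace ℝ (Fin 2)

/-- The Hilbert space `L²(ℝ²; ℂ)`. -/
abbrev L2Plane : Type := Lp ℂ 2 (volume : Measure Plane)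

/-- The Hilbert space `L²(ℝ; ℂ)`. -/
abbrev L2Line : Type := Lp ℂ 2 (volume : Measure ℝ)

/-- Rotation of a vector of the plane by a right angle. -/
def perp (u : Plane) : Plane := !₂[-(u 1), u 0]

/-- A finite metric graph embedded in `ℝ²` with straight edges; `J` indexes the edges. The edge
`j` is the segment (or half-line) `{start j + x • dir j : 0 ≤ x ≤ len j}`, of length
`len j ∈ (0, ∞]`, and `x` is the arc-length coordinate along it. -/
structure StraightMetricGraph (J : Type*) [Finite J] where
  /-- the (finite) set of vertices -/
  vertices : Finset Plane
  /-- the initial vertex of an edge -/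
  start : J → Plane
  /-- the unit direction of an edge -/
  dir : J → Plane
  /-- the length of an edge -/
  len : J → EReal
  norm_dir : ∀ j, ‖dir j‖ = 1
  len_pos : ∀ j, 0 < len j
  start_mem : ∀ j, start j ∈ vertices
  /-- an edge of finite length ends at a vertex -/
  end_mem : ∀ (j : J) (l : ℝ), len j = (l : EReal) → start j + l • dir j ∈ vertices
  /-- there are no isolated vertices -/
  no_isolated : ∀ v ∈ vertices,
    ∃ j, v = start j ∨ ∃ l : ℝ, len j = (l : EReal) ∧ v = start j + l • dir j
  /-- the graph is embedded: an interior point of an edge lies on no other edge -/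
  embedded : ∀ (j k : J) (x y : ℝ), 0 < x → (x : EReal) < len j → 0 ≤ y → (y : EReal) ≤ len k →
    start j + x • dir j = start k + y • dir k → j = k

/-! ### Transverse modes -/

/-- The `n`-th normalized eigenfunction of `-½ ∂²/∂y² + y²/(2ε²)`, with eigenvalue `(n + ½)/ε`:
`(πε)^(-1/4) (n!)^(-1/2) Heₙ(√2 y / √ε) exp(-y²/(2ε))`. Here `Polynomial.hermite n` is the
probabilists' polynomial `Heₙ`, and `Heₙ(√2 z) = 2^(-n/2) Hₙ(z)`. -/
def transverseMode (n : ℕ) (ε y : ℝ) : ℝ :=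
  (Real.pi * ε) ^ (-(1 / 4) : ℝ) * (Real.sqrt (Nat.factorial n))⁻¹ *
    Polynomial.aeval (Real.sqrt 2 * y / Real.sqrt ε) (Polynomial.hermite n) *
    Real.exp (-(y ^ 2 / (2 * ε)))

/-- The eigenvalue parameter `Eₙ = n + ½`. -/
def modeEnergy (n : ℕ) : ℝ := n + 1 / 2

theorem continuous_transverseMode (n : ℕ) (ε : ℝ) : Continuous (transverseMode n ε) := by
  unfold transverseMode
  fun_prop

theorem integrable_polynomial_mul_gaussian {b : ℝ} (hb : 0 < b) (P : Polynomial ℝ) :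
    Integrable (fun y : ℝ => P.eval y * Real.exp (-b * y ^ 2)) := by
  induction P using Polynomial.induction_on' with
  | add p q hp hq =>
    refine (hp.add hq).congr (Eventually.of_forall fun y => ?_)
    simp [add_mul]
  | monomial k a =>
    have h := (integrable_rpow_mul_exp_neg_mul_sq hb (s := (k : ℝ))
      (by have : (0 : ℝ) ≤ k := Nat.cast_nonneg k
          linarith)).const_mul a
    simpa [Real.rpow_natCast, mul_assoc] using h

theorem memLp_transverseMode (n : ℕ) {ε : ℝ} (hε : 0 < ε) :
    MemLp (fun y => (transverseMode n ε y : ℂ)) 2 := by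
  have hc := continuous_transverseMode n ε
  refine (memLp_two_iff_integrable_sq_norm
    (Complex.continuous_ofReal.comp hc).aestronglyMeasurable).2 ?_
  set Q : Polynomial ℝ := ((Polynomial.hermite n).map (Int.castRingHom ℝ)).comp
    (Polynomial.C (Real.sqrt 2 / Real.sqrt ε) * Polynomial.X) with hQ
  have h := (integrable_polynomial_mul_gaussian (b := 1 / ε) (by positivity)
    (Q ^ 2)).const_mul
      (((Real.pi * ε) ^ (-(1 / 4) : ℝ) * (Real.sqrt (Nat.factorial n))⁻¹) ^ 2)
  refine h.congr (Eventually.of_forall fun y => ?_)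
  have h1 : Polynomial.aeval (Real.sqrt 2 * y / Real.sqrt ε) (Polynomial.hermite n)
      = Q.eval y := by
    simp only [hQ, Polynomial.eval_comp, Polynomial.eval_mul, Polynomial.eval_C,
      Polynomial.eval_X, Polynomial.eval_map, Polynomial.aeval_def]
    congr 1
    ring
  have h2 : Real.exp (-(1 / ε) * y ^ 2) = Real.exp (-(y ^ 2 / (2 * ε))) ^ 2 := by
    rw [← Real.exp_nat_mul]
    congr 1
    field_simp
    push_cast
    ring
  simp only [Function.comp, Complex.norm_real, Real.norm_eq_abs, sq_abs, transverseMode, h1, h2,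
    Polynomial.eval_pow]
  ring

/-- `g` is the distributional gradient of `ψ`. -/
def HasWeakGradient (ψ : L2Plane) (g : Fin 2 → L2Plane) : Prop :=
  ∀ i, ∂_{(EuclideanSpace.single i (1 : ℝ) : Plane)} (ψ : 𝓢'(Plane, ℂ)) = (g i : 𝓢'(Plane, ℂ))

theorem HasWeakGradient.zero : HasWeakGradient 0 0 := by
  intro i
  have e := map_zero (Lp.toTemperedDistributionCLM ℂ (volume : Measure Plane) 2)
  rw [Lp.toTemperedDistributionCLM_apply] at e
  rw [Pi.zero_apply, e]
  exact map_zero (LineDeriv.lineDerivOpCLM ℂ 𝓢'(Plane, ℂ)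
    (EuclideanSpace.single i (1 : ℝ) : Plane))

theorem HasWeakGradient.add {ψ ψ' : L2Plane} {g g' : Fin 2 → L2Plane}
    (h : HasWeakGradient ψ g) (h' : HasWeakGradient ψ' g') :
    HasWeakGradient (ψ + ψ') (g + g') := by
  intro i
  have e := map_add (Lp.toTemperedDistributionCLM ℂ (volume : Measure Plane) 2)
  simp only [Lp.toTemperedDistributionCLM_apply] at e
  rw [e, Pi.add_apply, e, LineDerivAdd.lineDerivOp_add, h i, h' i]

theorem HasWeakGradient.smul (c : ℂ) {ψ : L2Plane} {g : Fin 2 → L2Plane}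
    (h : HasWeakGradient ψ g) : HasWeakGradient (c • ψ) (c • g) := by
  intro i
  have e := map_smul (Lp.toTemperedDistributionCLM ℂ (volume : Measure Plane) 2)
  simp only [Lp.toTemperedDistributionCLM_apply] at e
  rw [e, Pi.smul_apply, e, LineDerivSMul.lineDerivOp_smul, h i]

namespace StraightMetricGraph

variable {J : Type*} [Finite J] (Γ : StraightMetricGraph J)

/-- The graph as a subset of the plane. -/
def support : Set Plane :=
  {q | ∃ (j : J) (x : ℝ), 0 ≤ x ∧ (x : EReal) ≤ Γ.len j ∧ q = Γ.start j + x • Γ.dir j}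

/-- The distance `d_Γ(q)` of a point of the plane from the graph. -/
def distTo (q : Plane) : ℝ := Metric.infDist q Γ.support

/-! ### Cartesian coordinates attached to an edge -/

/-- The coordinates `(x_j, y_j)` of a point: along the edge `j` and orthogonal to it. -/
def coords (j : J) (q : Plane) : ℝ × ℝ :=
  (inner ℝ (Γ.dir j) (q - Γ.start j), inner ℝ (perp (Γ.dir j)) (q - Γ.start j))

/-- The point of the plane with given coordinates `(x_j, y_j)`. -/
def point (j : J) (z : ℝ × ℝ) : Plane :=
  Γ.start j + z.1 • Γ.dir j + z.2 • perp (Γ.dir j)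

theorem continuous_coords (j : J) : Continuous (Γ.coords j) := by
  unfold coords
  fun_prop

theorem continuous_point (j : J) : Continuous (Γ.point j) := by
  unfold point
  fun_prop

theorem sq_add_sq (j : J) : Γ.dir j 0 ^ 2 + Γ.dir j 1 ^ 2 = 1 := by
  have h := Γ.norm_dir j
  rw [EuclideanSpace.norm_eq, Real.sqrt_eq_one] at h
  simpa [Fin.sum_univ_two] using h

theorem coords_point (j : J) (z : ℝ × ℝ) : Γ.coords j (Γ.point j z) = z := by
  have h := Γ.sq_add_sq j
  ext <;> simp [coords, point, perp, PiLp.inner_apply, Fin.sum_univ_two]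
  · linear_combination z.1 * h
  · linear_combination z.2 * h

theorem point_coords (j : J) (q : Plane) : Γ.point j (Γ.coords j q) = q := by
  have h := Γ.sq_add_sq j
  ext i
  fin_cases i <;> simp [coords, point, perp, PiLp.inner_apply, Fin.sum_univ_two]
  · linear_combination (q 0 - Γ.start j 0) * h
  · linear_combination (q 1 - Γ.start j 1) * h

theorem measurePreserving_point (j : J) : MeasurePreserving (Γ.point j) := by
  have h := Γ.sq_add_sq j
  have hon : Orthonormal ℝ ![Γ.dir j, perp (Γ.dir j)] := by
    rw [orthonormal_iff_ite]
    intro a b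
    fin_cases a <;> fin_cases b <;>
      simp only [perp, PiLp.inner_apply, Fin.sum_univ_two] <;> simp <;> linarith
  have hsp := hon.linearIndependent.span_eq_top_of_card_eq_finrank' (by simp)
  set b : OrthonormalBasis (Fin 2) ℝ Plane := OrthonormalBasis.mk hon hsp.ge with hb
  have h1 : MeasurePreserving (fun z : ℝ × ℝ => (MeasurableEquiv.finTwoArrow (α := ℝ)).symm z) :=
    (volume_preserving_finTwoArrow ℝ).symm _
  have h2 := (b.measurePreserving_repr_symm.comp (PiLp.volume_preserving_toLp (Fin 2))).comp h1
  have h3 := (measurePreserving_add_left (volume : Measure Plane) (Γ.start j)).comp h2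
  convert! h3 using 1
  ext1 z
  simp only [point, Function.comp, ← OrthonormalBasis.sum_repr_symm, Fin.sum_univ_two, hb,
    OrthonormalBasis.coe_mk, add_assoc]
  rfl

theorem measurePreserving_coords (j : J) : MeasurePreserving (Γ.coords j) := by
  have h := Γ.measurePreserving_point j
  refine ⟨(Γ.continuous_coords j).measurable, ?_⟩
  rw [← h.map_eq, Measure.map_map (Γ.continuous_coords j).measurable h.measurable]
  have : Γ.coords j ∘ Γ.point j = id := funext fun z => Γ.coords_point j z
  rw [this, Measure.map_id]

/-! ### The Hamiltonian -/

/-- `w = d_Γ ψ` almost everywhere. -/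
def IsDistMul (ψ w : L2Plane) : Prop := ∀ᵐ q, w q = (Γ.distTo q : ℂ) * ψ q

/-- The graph of the operator associated with the quadratic form
`½ ‖∇ψ‖² + (1/(2ε²)) ‖d_Γ ψ‖²` with form domain `{ψ ∈ H¹(ℝ²) : d_Γ ψ ∈ L²(ℝ²)}`: the pair `(ψ, η)`
belongs to it iff `ψ` is in the form domain and the sesquilinear form satisfies `q(φ, ψ) = ⟨φ, η⟩`
for every `φ` in the form domain. -/
def hamiltonianGraph (ε : ℝ) : Submodule ℂ (L2Plane × L2Plane) where
  carrier := {p | ∃ (g : Fin 2 → L2Plane) (w : L2Plane),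
    HasWeakGradient p.1 g ∧ Γ.IsDistMul p.1 w ∧
    ∀ (φ : L2Plane) (h : Fin 2 → L2Plane) (v : L2Plane),
      HasWeakGradient φ h → Γ.IsDistMul φ v →
      (1 / 2 : ℂ) * ∑ i, inner ℂ (h i) (g i) + (1 / (2 * (ε : ℂ) ^ 2)) * inner ℂ v w
        = inner ℂ φ p.2}
  zero_mem' := by
    refine ⟨0, 0, HasWeakGradient.zero, ?_, fun φ h v _ _ => by simp⟩
    filter_upwards [Lp.coeFn_zero ℂ 2 (volume : Measure Plane)] with q hq
    simp only [Prod.fst_zero, hq, Pi.zero_apply, mul_zero]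
  add_mem' := by
    rintro p p' ⟨g, w, hg, hw, hq⟩ ⟨g', w', hg', hw', hq'⟩
    refine ⟨g + g', w + w', HasWeakGradient.add hg hg', ?_, fun φ h v hφ hv => ?_⟩
    · filter_upwards [hw, hw', Lp.coeFn_add w w', Lp.coeFn_add p.1 p'.1] with q h1 h2 h3 h4
      rw [h3, Prod.fst_add, h4, Pi.add_apply, Pi.add_apply, h1, h2]
      ring
    · have e1 := hq φ h v hφ hv
      have e2 := hq' φ h v hφ hv
      simp only [Pi.add_apply, inner_add_right, Finset.sum_add_distrib, Prod.snd_add]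
      linear_combination e1 + e2
  smul_mem' := by
    rintro c p ⟨g, w, hg, hw, hq⟩
    refine ⟨c • g, c • w, HasWeakGradient.smul c hg, ?_, fun φ h v hφ hv => ?_⟩
    · filter_upwards [hw, Lp.coeFn_smul c w, Lp.coeFn_smul c p.1] with q h1 h3 h4
      rw [h3, Prod.smul_fst, h4, Pi.smul_apply, Pi.smul_apply, h1, smul_eq_mul, smul_eq_mul]
      ring
    · have e1 := hq φ h v hφ hv
      simp only [Pi.smul_apply, inner_smul_right, ← Finset.mul_sum, Prod.smul_snd]
      linear_combination c * e1

/-- The graph above is the graph of an operator: the form domain is dense in `L²(ℝ²)`. -/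
theorem hamiltonianGraph_unique (ε : ℝ) (p : L2Plane × L2Plane) (hp : p ∈ Γ.hamiltonianGraph ε)
    (h0 : p.1 = 0) : p.2 = 0 := by
  obtain ⟨g, w, hg, hw, hq⟩ := hp
  have hg0 : ∀ i, g i = 0 := by
    intro i
    have hker := Lp.ker_toTemperedDistributionCLM_eq_bot (F := ℂ)
      (μ := (volume : Measure Plane)) (p := 2)
    have h1 := hg i
    rw [h0] at h1
    have h2 : Lp.toTemperedDistributionCLM ℂ (volume : Measure Plane) 2 (g i) = 0 := by
      rw [Lp.toTemperedDistributionCLM_apply, ← h1]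
      have e := map_zero (Lp.toTemperedDistributionCLM ℂ (volume : Measure Plane) 2)
      rw [Lp.toTemperedDistributionCLM_apply] at e
      rw [e]
      exact map_zero (LineDeriv.lineDerivOpCLM ℂ 𝓢'(Plane, ℂ)
        (EuclideanSpace.single i (1 : ℝ) : Plane))
    exact (LinearMap.ker_eq_bot'.1 hker) _ h2
  have hw0 : w = 0 := by
    rw [Lp.eq_zero_iff_ae_eq_zero]
    rw [h0] at hw
    filter_upwards [hw, Lp.coeFn_zero ℂ 2 (volume : Measure Plane)] with q h1 h2
    simp [h1]
  have key : ∀ φ : Plane → ℂ, ContDiff ℝ ∞ φ → ∀ hc : HasCompactSupport φ, 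
      ∀ hφ : MemLp φ 2, inner ℂ hφ.toLp p.2 = 0 := by
    intro φ hs hc hφ
    have hd : Continuous Γ.distTo := Metric.continuous_infDist_pt _
    have hv : MemLp (fun q => (Γ.distTo q : ℂ) * φ q) 2 :=
      ((Complex.continuous_ofReal.comp hd).mul hs.continuous).memLp_of_hasCompactSupport
        hc.mul_left
    set S : 𝓢(Plane, ℂ) := hc.toSchwartzMap hs with hS
    have hSφ : hφ.toLp = S.toLp 2 volume := by
      rw [Lp.ext_iff]
      filter_upwards [hφ.coeFn_toLp, S.coeFn_toLp 2 volume] with q h1 h2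
      rw [h1, h2]
      rfl
    have := hq hφ.toLp (fun i => (∂_{(EuclideanSpace.single i (1 : ℝ) : Plane)} S).toLp 2 volume)
      hv.toLp (fun i => ?_) ?_
    · rw [← this]
      simp [hg0, hw0]
    · rw [hSφ, Lp.toTemperedDistribution_toLp_eq, Lp.toTemperedDistribution_toLp_eq]
      exact TemperedDistribution.lineDerivOp_toTemperedDistributionCLM_eq S _
    · filter_upwards [hφ.coeFn_toLp, hv.coeFn_toLp] with q h1 h2
      rw [h1, h2]
  have hsmall : ∀ δ : ℝ, 0 < δ → ‖p.2‖ ≤ δ := by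
    intro δ hδ
    obtain ⟨φ, hc, hs, hle⟩ := MemLp.exist_eLpNorm_sub_le (p := 2) (by simp) (by simp)
      (Lp.memLp p.2) hδ
    have hφ : MemLp φ 2 := hs.continuous.memLp_of_hasCompactSupport hc
    have h1 : ‖p.2 - hφ.toLp‖ ≤ δ := by
      rw [Lp.norm_def]
      refine ENNReal.toReal_le_of_le_ofReal hδ.le (le_trans (le_of_eq ?_) hle)
      refine eLpNorm_congr_ae ?_
      filter_upwards [Lp.coeFn_sub p.2 hφ.toLp, hφ.coeFn_toLp] with q h1 h2
      rw [h1, Pi.sub_apply, Pi.sub_apply, h2]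
    have h2 : inner ℂ (p.2 - hφ.toLp) p.2 = inner ℂ p.2 p.2 := by
      rw [inner_sub_left, key φ hs hc hφ, sub_zero]
    have h3 : ‖p.2‖ * ‖p.2‖ ≤ δ * ‖p.2‖ := by
      have h4 := norm_inner_le_norm (𝕜 := ℂ) (p.2 - hφ.toLp) p.2
      rw [h2, inner_self_eq_norm_sq_to_K] at h4
      have h5 : ‖((‖p.2‖ : ℂ)) ^ 2‖ = ‖p.2‖ * ‖p.2‖ := by
        rw [norm_pow, Complex.norm_real, norm_norm, sq]
      have h6 : ‖p.2‖ * ‖p.2‖ ≤ ‖p.2 - hφ.toLp‖ * ‖p.2‖ := h5 ▸ h4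
      exact h6.trans (mul_le_mul_of_nonneg_right h1 (norm_nonneg _))
    by_contra hlt
    push Not at hlt
    nlinarith
  exact norm_le_zero_iff.1 (le_of_forall_pos_le_add fun δ hδ => by simpa using hsmall δ hδ)

/-- The Hamiltonian `Ĥ(ε) = -½ Δ + d_Γ²/(2ε²)` on `L²(ℝ²)`. -/
def hamiltonian (ε : ℝ) : L2Plane →ₗ.[ℂ] L2Plane := (Γ.hamiltonianGraph ε).toLinearPMap

theorem graph_hamiltonian (ε : ℝ) : (Γ.hamiltonian ε).graph = Γ.hamiltonianGraph ε :=
  Submodule.toLinearPMap_graph_eq _ (Γ.hamiltonianGraph_unique ε)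

/-- The Hamiltonian `H̃(ε) = Ĥ(ε) - Eₙ/ε`. -/
def shiftedHamiltonian (n : ℕ) (ε : ℝ) : L2Plane →ₗ.[ℂ] L2Plane :=
  (-((modeEnergy n / ε : ℝ) : ℂ)) • (LinearMap.id : L2Plane →ₗ[ℂ] L2Plane) +ᵥ Γ.hamiltonian ε

end StraightMetricGraph

/-- `U` is the strongly continuous one-parameter unitary group `exp(-itA)`: its generator, with its
exact domain, is `-iA`. -/
structure IsUnitaryGroupOf {E : Type*} [NormedAddCommGroup E] [InnerProductSpace ℂ E]
    (A : E →ₗ.[ℂ] E) (U : ℝ → E ≃ₗᵢ[ℂ] E) : Prop where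
  map_zero : ∀ ψ, U 0 ψ = ψ
  map_add : ∀ s t ψ, U (s + t) ψ = U s (U t ψ)
  continuous : ∀ ψ, Continuous fun t => U t ψ
  generator : ∀ ψ η, (ψ, η) ∈ A.graph ↔ HasDerivAt (fun t => U t ψ) (-(Complex.I • η)) 0

open Classical in
/-- The unitary group `exp(-itA)` (the identity if `A` generates none; a group is determined by its
generator, so the choice is unique). -/
def expNegI {E : Type*} [NormedAddCommGroup E] [InnerProductSpace ℂ E]
    (A : E →ₗ.[ℂ] E) : ℝ → E ≃ₗᵢ[ℂ] E :=
  if h : ∃ U, IsUnitaryGroupOf A U then h.choose else fun _ => LinearIsometryEquiv.refl ℂ E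

namespace StraightMetricGraph

variable {J : Type*} [Finite J] (Γ : StraightMetricGraph J)

/-! ### Initial state, evolution and transverse components -/

/-- `f ∈ C₀^∞(0, l_{e_j})`. -/
structure IsTestFunctionOn (j : J) (f : ℝ → ℂ) : Prop where
  contDiff : ContDiff ℝ ∞ f
  hasCompactSupport : HasCompactSupport f
  tsupport_subset : tsupport f ⊆ {x | 0 < x ∧ (x : EReal) < Γ.len j}

theorem memLp_initial {j : J} {f : ℝ → ℂ} (hf : Γ.IsTestFunctionOn j f) (n : ℕ) {ε : ℝ}
    (hε : 0 < ε) :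
    MemLp (fun q : Plane => f (Γ.coords j q).1 * (transverseMode n ε (Γ.coords j q).2 : ℂ)) 2 := by
  have h1 : MemLp f 2 := hf.contDiff.continuous.memLp_of_hasCompactSupport hf.hasCompactSupport
  have h2 := memLp_transverseMode n hε
  have h : MemLp (fun z : ℝ × ℝ => f z.1 * (transverseMode n ε z.2 : ℂ)) 2 := by
    have hm : AEStronglyMeasurable (fun z : ℝ × ℝ => f z.1 * (transverseMode n ε z.2 : ℂ)) :=
      ((hf.contDiff.continuous.comp continuous_fst).mul
        (Complex.continuous_ofReal.comp
          ((continuous_transverseMode n ε).comp continuous_snd))).aestronglyMeasurable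
    rw [memLp_two_iff_integrable_sq_norm hm]
    have := h1.integrable_norm_pow two_ne_zero |>.mul_prod (h2.integrable_norm_pow two_ne_zero)
    simpa [mul_pow] using! this
  exact h.comp_measurePreserving (Γ.measurePreserving_coords j)

/-- The initial state `ψ₀ = f(x_j) Φₙ^ε(y_j)`. -/
def initialState {j : J} {f : ℝ → ℂ} (hf : Γ.IsTestFunctionOn j f) (n : ℕ) {ε : ℝ}
    (hε : 0 < ε) : L2Plane := (Γ.memLp_initial hf n hε).toLp

/-- The evolved state `ψ_t^ε = exp(-it H̃(ε)) ψ₀`. -/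
def evolvedState {j : J} {f : ℝ → ℂ} (hf : Γ.IsTestFunctionOn j f) (n : ℕ) {ε : ℝ}
    (hε : 0 < ε) (t : ℝ) : L2Plane :=
  expNegI (Γ.shiftedHamiltonian n ε) t (Γ.initialState hf n hε)

theorem memLp_projection (j : J) (m : ℕ) {ε : ℝ} (hε : 0 < ε) (ψ : L2Plane) :
    MemLp (fun x : ℝ => ∫ y : ℝ, conj (transverseMode m ε y : ℂ) * ψ (Γ.point j (x, y))) 2 := by
  set F : ℝ × ℝ → ℂ := fun z => ψ (Γ.point j z) with hF
  have hFm : MemLp F 2 := (Lp.memLp ψ).comp_measurePreserving (Γ.measurePreserving_point j)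
  have hΦ := memLp_transverseMode m hε
  have hmeas : AEStronglyMeasurable
      (fun z : ℝ × ℝ => conj (transverseMode m ε z.2 : ℂ) * F z) (volume.prod volume) :=
    (Complex.continuous_conj.comp (Complex.continuous_ofReal.comp
      ((continuous_transverseMode m ε).comp continuous_snd))).aestronglyMeasurable.mul hFm.1
  have hsq : Integrable (fun z => ‖F z‖ ^ 2) (volume.prod volume) :=
    hFm.integrable_norm_pow two_ne_zero
  refine (memLp_two_iff_integrable_sq_norm hmeas.integral_prod_right').2 ?_
  refine Integrable.mono' (hsq.integral_prod_left.const_mul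
    (∫ y, ‖(transverseMode m ε y : ℂ)‖ ^ 2))
    (hmeas.integral_prod_right'.norm.pow 2) ?_
  filter_upwards [hsq.prod_right_ae, hFm.1.prodMk_left] with x hx hxm
  have hFx : MemLp (fun y => F (x, y)) 2 := (memLp_two_iff_integrable_sq_norm hxm).2 hx
  have hle : ‖∫ y, conj (transverseMode m ε y : ℂ) * F (x, y)‖ ≤
      ∫ y, ‖(transverseMode m ε y : ℂ)‖ * ‖F (x, y)‖ := by
    refine (norm_integral_le_integral_norm _).trans (le_of_eq ?_)
    simp
  have hcs := integral_mul_le_Lp_mul_Lq_of_nonneg (μ := (volume : Measure ℝ))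
    Real.HolderConjugate.two_two
    (Eventually.of_forall fun y => norm_nonneg (transverseMode m ε y : ℂ))
    (Eventually.of_forall fun y => norm_nonneg (F (x, y)))
    (by simpa using hΦ.norm) (by simpa using hFx.norm)
  have ha : 0 ≤ ∫ y, ‖(transverseMode m ε y : ℂ)‖ ^ 2 := integral_nonneg fun y => by positivity
  have hb : 0 ≤ ∫ y, ‖F (x, y)‖ ^ 2 := integral_nonneg fun y => by positivity
  simp only [Real.rpow_two, ← Real.sqrt_eq_rpow] at hcs
  rw [Real.norm_eq_abs, abs_of_nonneg (by positivity)]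
  calc _ ≤ (Real.sqrt (∫ y, ‖(transverseMode m ε y : ℂ)‖ ^ 2) *
        Real.sqrt (∫ y, ‖F (x, y)‖ ^ 2)) ^ 2 :=
        pow_le_pow_left₀ (norm_nonneg _) (hle.trans hcs) 2
    _ = _ := by rw [mul_pow, Real.sq_sqrt ha, Real.sq_sqrt hb]

/-- The projection `x_j ↦ ∫ dy_j Φₘ^ε(y_j)^* ψ(x_j, y_j)` on the `m`-th transverse mode of the
edge `j`. -/
def projection (j : J) (m : ℕ) {ε : ℝ} (hε : 0 < ε) (ψ : L2Plane) : L2Line :=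
  (Γ.memLp_projection j m hε ψ).toLp

/-- The transverse component `s_j^m(t, · ; ε)` of the evolution of the initial state
`f(x_{j₀}) Φₙ^ε(y_{j₀})`. -/
def component {j₀ : J} {f : ℝ → ℂ} (hf : Γ.IsTestFunctionOn j₀ f) (n : ℕ) (j : J) (m : ℕ)
    {ε : ℝ} (hε : 0 < ε) (t : ℝ) : L2Line :=
  Γ.projection j m hε (Γ.evolvedState hf n hε t)

end StraightMetricGraph

/-! ### The limit -/

/-- The functions `F k` converge to `G` in the weak-* topology of `L^∞((0, T), L²(ℝ))`, the dual of
`L¹((0, T), L²(ℝ))`. -/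
structure WeakStarTendsto (T : ℝ) (F : ℕ → ℝ → L2Line) (G : ℝ → L2Line) : Prop where
  memLp : ∀ k, MemLp (F k) ∞ (volume.restrict (Ioo 0 T))
  memLp_limit : MemLp G ∞ (volume.restrict (Ioo 0 T))
  tendsto : ∀ g : ℝ → L2Line, Integrable g (volume.restrict (Ioo 0 T)) →
    Tendsto (fun k => ∫ t in Ioo 0 T, inner ℂ (g t) (F k t)) atTop
      (𝓝 (∫ t in Ioo 0 T, inner ℂ (g t) (G t)))

/-- `i ∂_t s = -½ ∂_x² s` in `𝓓'((0, T) × (0, l))`, where `s` acts on a test function `φ` by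
`∫_0^T (∫ s(t)(x) φ(t, x) dx) dt`. -/
def SolvesFreeSchrodinger (T : ℝ) (l : EReal) (s : ℝ → L2Line) : Prop :=
  ∀ φ : ℝ × ℝ → ℂ, ContDiff ℝ ∞ φ → HasCompactSupport φ →
    tsupport φ ⊆ {z | 0 < z.1 ∧ z.1 < T ∧ 0 < z.2 ∧ (z.2 : EReal) < l} →
    ∫ t in Ioo 0 T, ∫ x : ℝ, s t x * (-(Complex.I * deriv (fun τ => φ (τ, x)) t)) =
      ∫ t in Ioo 0 T, ∫ x : ℝ, s t x * (-(1 / 2 : ℂ) * iteratedDeriv 2 (fun ξ => φ (t, ξ)) x)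

end

/-! The limit equation is tested only against smooth functions whose support in $x_j$ is a compact
subset of the open edge, so no information about the vertices is needed. `lift` sends $\theta$ to
$\theta(x_j)\Phi_n^\varepsilon(y_j)$, and `projection` is its adjoint (`projection_eq_adjoint`).
Pairing a component with a test function $a$ is therefore the same as pairing the evolved state with
the lift of $a$.

If $d_\Gamma$ were equal to $|y_j|$, the transverse oscillator would contribute exactly
$E_n/\varepsilon$, and $\widetilde H(\varepsilon)$ would map the lift of $a$ to the lift of
$-\tfrac12 a''$. Over the support of $a$ this equality does hold for $|y_j|<\delta$
(`exists_distTo_eq`), and elsewhere $0\le d_\Gamma\le|y_j|$. The error thus sits in the Gaussian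
tail of $\Phi_n^\varepsilon$, which has width $\sqrt\varepsilon$, and it is $O(\varepsilon)$ in norm
(`exists_mem_shiftedHamiltonian_norm_le`). Symmetry of $\widetilde H(\varepsilon)$ moves the
generator from the evolved state to the lifted test function, so each component satisfies the weak
free Schrödinger equation up to $O(\varepsilon)$ (`norm_integral_component_le`).

The equation is linear and passes to weak-* limits. These exist along a subsequence because
unitarity and the $\varepsilon$-independence of $\|\Phi_n^\varepsilon\|$ bound all components
uniformly (`norm_component_le`, `exists_weakStarTendsto`).

The unitary group is built from the resolvent. With the form norm the form domain is a Hilbert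
space; if $\iota$ is its inclusion in $L^2$, then $R=\iota\iota^*$ is bounded, self-adjoint,
injective and equal to $(\widehat H+1)^{-1}$ (`mem_hamiltonianGraph_iff`). The symbol
$x\,e^{-it(1/x-a)}$ is continuous on all of $\mathbb R$, so the continuous functional calculus of
$R$ defines $R\,e^{-it(1/R-a)}$. This has the same norm as $R$ on every vector, hence extends from
the dense range of $R$ to a unitary (`exists_isUnitaryGroupOf`). -/

/-! ### Unitary groups from injective self-adjoint operators -/

section StoneGroup

/-- The symbol `x ↦ x exp(-it(1/x - a))`, extended by `0` at `x = 0`. -/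
noncomputable def regularizedPhase (a t x : ℝ) : ℂ := x * Complex.exp (Complex.I * ((-(t * (x⁻¹ - a)) : ℝ) : ℂ))

theorem norm_exp_I_mul_ofReal' (u : ℝ) : ‖Complex.exp (Complex.I * (u : ℂ))‖ = 1 := by
  rw [mul_comm, Complex.norm_exp_ofReal_mul_I]

/-- The phase oscillates wildly at $x=0$, but the prefactor gives the symbol modulus $|x|$ there.
This is the reason for carrying the prefactor. -/
theorem continuous_regularizedPhase (a t : ℝ) : Continuous (regularizedPhase a t) := by
  refine continuous_iff_continuousAt.2 fun x => ?_
  by_cases hx : x = 0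
  · subst hx
    have h0 : regularizedPhase a t 0 = 0 := by simp [regularizedPhase]
    rw [ContinuousAt, h0, tendsto_zero_iff_norm_tendsto_zero]
    have : (fun x => ‖regularizedPhase a t x‖) = fun x => |x| := by
      ext x
      rw [regularizedPhase, norm_mul, norm_exp_I_mul_ofReal', mul_one, Complex.norm_real,
        Real.norm_eq_abs]
    rw [this]
    simpa using (continuous_abs.tendsto (0 : ℝ))
  · have h1 : ContinuousAt (fun x : ℝ => -(t * (x⁻¹ - a))) x :=
      ((continuousAt_const.mul ((continuousAt_inv₀ hx).sub continuousAt_const))).neg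
    have h2 : ContinuousAt (fun x : ℝ => ((-(t * (x⁻¹ - a)) : ℝ) : ℂ)) x :=
      Complex.continuous_ofReal.continuousAt.comp h1
    exact Complex.continuous_ofReal.continuousAt.mul
      (Complex.continuous_exp.continuousAt.comp (continuousAt_const.mul h2))

theorem regularizedPhase_mul (a s t x : ℝ) :
    regularizedPhase a s x * regularizedPhase a t x = x * regularizedPhase a (s + t) x := by
  have : Complex.exp (Complex.I * ((-((s + t) * (x⁻¹ - a)) : ℝ) : ℂ)) =
      Complex.exp (Complex.I * ((-(s * (x⁻¹ - a)) : ℝ) : ℂ)) *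
      Complex.exp (Complex.I * ((-(t * (x⁻¹ - a)) : ℝ) : ℂ)) := by
    rw [← Complex.exp_add]
    congr 1
    push_cast
    ring
  rw [regularizedPhase, regularizedPhase, regularizedPhase, this]
  ring

theorem star_regularizedPhase (a t x : ℝ) :
    star (regularizedPhase a t x) = regularizedPhase a (-t) x := by
  simp [regularizedPhase, ← Complex.exp_conj]

theorem regularizedPhase_zero (a x : ℝ) : regularizedPhase a 0 x = x := by
  simp [regularizedPhase]

/-- For $|u|\le1$ this is Taylor's bound; for $|u|>1$ the triangle inequality gives $2|u|\le 3u^2$.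
Having one bound for all $u$ matters because $1/x$ is unbounded. -/
theorem norm_exp_I_sub_one_add_le (u : ℝ) :
    ‖Complex.exp (Complex.I * (u : ℂ)) - 1 - Complex.I * u‖ ≤ 3 * u ^ 2 := by
  have hn : ‖Complex.I * (u : ℂ)‖ = |u| := by simp
  by_cases hu : |u| ≤ 1
  · have := Complex.norm_exp_sub_one_sub_id_le (x := Complex.I * (u : ℂ)) (by rw [hn]; exact hu)
    rw [hn, sq_abs] at this
    nlinarith [sq_nonneg u]
  · push Not at hu
    have h1 := norm_sub_le (Complex.exp (Complex.I * (u : ℂ)) - 1) (Complex.I * u)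
    have h2 := Real.norm_exp_I_mul_ofReal_sub_one_le (x := u)
    rw [hn] at h1
    rw [Real.norm_eq_abs] at h2
    nlinarith [sq_abs u]

/-- `regularizedPhase` minus its first-order Taylor polynomial in `t`. -/
theorem norm_regularizedPhase_sub_le (a t x : ℝ) :
    ‖regularizedPhase a t x - x + Complex.I * t * (1 - a * x)‖ ≤ 2 * |1 - a * x| * |t| ∧
    ‖(x : ℂ) * (regularizedPhase a t x - x + Complex.I * t * (1 - a * x))‖
      ≤ 3 * |1 - a * x| ^ 2 * t ^ 2 := by
  by_cases hx : x = 0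
  · subst hx
    refine ⟨?_, ?_⟩
    · simp [regularizedPhase]
      linarith [abs_nonneg t]
    · simp
      positivity
  -- One factor $x$ turns the unbounded $u$ into $xu=-t(1-ax)$. The first bound spends one such
  -- factor on $2|u|$, the second spends two on $3u^2$.
  set u : ℝ := -(t * (x⁻¹ - a)) with hu
  have hxu : x * u = -(t * (1 - a * x)) := by rw [hu]; field_simp
  have hxu' : (x : ℂ) * u = -(t * (1 - a * x)) := by exact_mod_cast hxu
  have e : regularizedPhase a t x - x + Complex.I * t * (1 - a * x) =
      x * (Complex.exp (Complex.I * (u : ℂ)) - 1 - Complex.I * u) := by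
    rw [regularizedPhase]
    linear_combination Complex.I * hxu'
  have habs : |x| * |u| = |t| * |1 - a * x| := by
    rw [← abs_mul, hxu, abs_neg, abs_mul]
  rw [e]
  constructor
  · rw [norm_mul, Complex.norm_real, Real.norm_eq_abs]
    have h1 := norm_sub_le (Complex.exp (Complex.I * (u : ℂ)) - 1) (Complex.I * u)
    have h2 := Real.norm_exp_I_mul_ofReal_sub_one_le (x := u)
    have hn : ‖Complex.I * (u : ℂ)‖ = |u| := by simp
    rw [hn] at h1
    rw [Real.norm_eq_abs] at h2
    have h3 := mul_le_mul_of_nonneg_left (h1.trans (add_le_add_left h2 _)) (abs_nonneg x)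
    nlinarith [abs_nonneg t]
  · rw [norm_mul, norm_mul, Complex.norm_real, Real.norm_eq_abs]
    have h1 := norm_exp_I_sub_one_add_le u
    have h3 := mul_le_mul_of_nonneg_left (mul_le_mul_of_nonneg_left h1 (abs_nonneg x))
      (abs_nonneg x)
    have h4 : |x| * (|x| * (3 * u ^ 2)) = 3 * (|x| * |u|) ^ 2 := by rw [← sq_abs u]; ring
    rw [h4, habs, mul_pow, sq_abs t] at h3
    linarith

variable {E : Type*} [NormedAddCommGroup E] [InnerProductSpace ℂ E] [CompleteSpace E]

/-- The continuous functional calculus of a self-adjoint operator, for complex-valued functions of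
a real variable. -/
noncomputable def realCfc (R : E →L[ℂ] E) (f : ℝ → ℂ) : E →L[ℂ] E := cfc (fun z : ℂ => f z.re) R

variable {R : E →L[ℂ] E}

theorem realCfc_id (hR : IsSelfAdjoint R) : realCfc R (fun x => (x : ℂ)) = R := by
  have := hR.isStarNormal
  rw [realCfc]
  conv_rhs => rw [← cfc_id' ℂ R]
  refine cfc_congr fun z hz => ?_
  exact (hR.mem_spectrum_eq_re hz).symm

/-- The spectrum lies in the ball of radius `‖R‖`, so only the values of `f` on that interval
matter. -/
theorem norm_realCfc_le {f : ℝ → ℂ} {C : ℝ} (hC : 0 ≤ C)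
    (h : ∀ x : ℝ, |x| ≤ ‖R‖ → ‖f x‖ ≤ C) : ‖realCfc R f‖ ≤ C := by
  refine norm_cfc_le hC fun z hz => h _ ((Complex.abs_re_le_norm z).trans ?_)
  have h1 := spectrum.norm_le_norm_mul_of_mem hz
  have h2 : ‖(1 : E →L[ℂ] E)‖ ≤ 1 := ContinuousLinearMap.norm_id_le
  nlinarith [norm_nonneg R]

theorem realCfc_mul (f g : ℝ → ℂ) (hf : Continuous f) (hg : Continuous g) :
    realCfc R (fun x => f x * g x) = realCfc R f * realCfc R g := 
  cfc_mul (fun z : ℂ => f z.re) (fun z : ℂ => g z.re) R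
    (hf.comp Complex.continuous_re).continuousOn (hg.comp Complex.continuous_re).continuousOn

theorem realCfc_sub (f g : ℝ → ℂ) (hf : Continuous f) (hg : Continuous g) :
    realCfc R (fun x => f x - g x) = realCfc R f - realCfc R g := 
  cfc_sub (fun z : ℂ => f z.re) (fun z : ℂ => g z.re) R
    (hf.comp Complex.continuous_re).continuousOn (hg.comp Complex.continuous_re).continuousOn

theorem realCfc_add (f g : ℝ → ℂ) (hf : Continuous f) (hg : Continuous g) :
    realCfc R (fun x => f x + g x) = realCfc R f + realCfc R g := 
  cfc_add R (fun z : ℂ => f z.re) (fun z : ℂ => g z.re)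
    (hf.comp Complex.continuous_re).continuousOn (hg.comp Complex.continuous_re).continuousOn

theorem realCfc_star (f : ℝ → ℂ) : realCfc R (fun x => star (f x)) = star (realCfc R f) := 
  cfc_star (fun z : ℂ => f z.re) R

theorem realCfc_const_mul (c : ℂ) (f : ℝ → ℂ) (hf : Continuous f) :
    realCfc R (fun x => c * f x) = c • realCfc R f := 
  cfc_const_mul c (fun z : ℂ => f z.re) R (hf.comp Complex.continuous_re).continuousOn

theorem realCfc_one (hR : IsSelfAdjoint R) : realCfc R (fun _ => 1) = 1 := by
  have := hR.isStarNormal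
  exact cfc_const_one ℂ R

theorem continuous_ofReal' : Continuous fun x : ℝ => (x : ℂ) := Complex.continuous_ofReal

/-- The operator `R exp(-it(1/R - a))`. -/
noncomputable def regularizedGroup (R : E →L[ℂ] E) (a t : ℝ) : E →L[ℂ] E :=
  realCfc R (regularizedPhase a t)

/-- This is the group law multiplied by $R^2$; every later property of the group is read off from
it. -/
theorem regularizedGroup_mul (hR : IsSelfAdjoint R) (a s t : ℝ) :
    regularizedGroup R a s * regularizedGroup R a t = R * regularizedGroup R a (s + t) := by
  conv_rhs => rw [← realCfc_id hR]
  simp only [regularizedGroup]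
  rw [realCfc_id hR]
  conv_rhs => arg 1; rw [← realCfc_id hR]
  rw [← realCfc_mul _ _ (continuous_regularizedPhase a s) (continuous_regularizedPhase a t),
    ← realCfc_mul _ _ continuous_ofReal' (continuous_regularizedPhase a (s + t))]
  simp_rw [regularizedPhase_mul]

theorem regularizedGroup_zero (hR : IsSelfAdjoint R) (a : ℝ) : regularizedGroup R a 0 = R := by
  have : regularizedPhase a 0 = fun x : ℝ => (x : ℂ) := funext fun x => regularizedPhase_zero a x
  rw [regularizedGroup, this, realCfc_id hR]

theorem star_regularizedGroup (a t : ℝ) :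
    star (regularizedGroup R a t) = regularizedGroup R a (-t) := by
  rw [regularizedGroup, ← realCfc_star]
  simp_rw [star_regularizedPhase]
  rfl

theorem regularizedGroup_comm (hR : IsSelfAdjoint R) (a t : ℝ) :
    regularizedGroup R a t * R = R * regularizedGroup R a t := by
  have := regularizedGroup_mul hR a t 0
  rwa [regularizedGroup_zero hR, add_zero] at this

/-- Both operators have the same $S^*S$, because the adjoint reverses time and the phases cancel.
This isometry relative to $R$ is what allows the extension from the range of $R$. -/
theorem norm_regularizedGroup_apply (hR : IsSelfAdjoint R) (a t : ℝ) (χ : E) :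
    ‖regularizedGroup R a t χ‖ = ‖R χ‖ := by
  have h : star (regularizedGroup R a t) * regularizedGroup R a t = star R * R := by
    rw [star_regularizedGroup, regularizedGroup_mul hR, neg_add_cancel, regularizedGroup_zero hR,
      hR.star_eq]
  have key : ∀ S : E →L[ℂ] E, ‖S χ‖ ^ 2 = RCLike.re (inner ℂ ((star S * S) χ) χ) := fun S => by
    rw [ContinuousLinearMap.star_eq_adjoint, mul_apply_eq_comp,
      ContinuousLinearMap.adjoint_inner_left, inner_self_eq_norm_sq]
  have h2 : ‖regularizedGroup R a t χ‖ ^ 2 = ‖R χ‖ ^ 2 := by rw [key, key, h]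
  exact (pow_left_inj₀ (norm_nonneg _) (norm_nonneg _) two_ne_zero).1 h2

/-- The first-order remainder of `regularizedGroup` in time, and its regularization. -/
theorem norm_regularizedGroup_sub_le (hR : IsSelfAdjoint R) (a : ℝ) : ∃ C : ℝ, 0 ≤ C ∧ ∀ t χ,
    ‖regularizedGroup R a t χ - R χ + (Complex.I * t) • (χ - (a : ℂ) • R χ)‖ ≤ C * |t| * ‖χ‖ ∧
    ‖R (regularizedGroup R a t χ - R χ + (Complex.I * t) • (χ - (a : ℂ) • R χ))‖
      ≤ C * t ^ 2 * ‖χ‖ := by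
  set M : ℝ := 1 + |a| * ‖R‖ with hM
  have hM1 : 1 ≤ M := by have := mul_nonneg (abs_nonneg a) (norm_nonneg R); linarith
  have hx : ∀ x : ℝ, |x| ≤ ‖R‖ → |1 - a * x| ≤ M := fun x hx => by
    calc |1 - a * x| ≤ |1| + |a * x| := abs_sub _ _
      _ ≤ M := by
        rw [abs_mul, abs_one]
        linarith [mul_le_mul_of_nonneg_left hx (abs_nonneg a)]
  refine ⟨3 * M ^ 2, by positivity, fun t χ => ?_⟩
  set f : ℝ → ℂ := fun x => regularizedPhase a t x - x + Complex.I * t * (1 - a * x) with hf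
  have hfc : Continuous f := by
    have := continuous_regularizedPhase a t
    fun_prop
  have e : realCfc R f = regularizedGroup R a t - R + (Complex.I * t) • (1 - (a : ℂ) • R) := by
    have h1 := continuous_regularizedPhase a t
    rw [hf, realCfc_add _ _ (by fun_prop) (by fun_prop), realCfc_sub _ _ (by fun_prop)
      (by fun_prop), realCfc_const_mul _ _ (by fun_prop), realCfc_sub _ _ (by fun_prop)
      (by fun_prop), realCfc_const_mul _ _ (by fun_prop), realCfc_one hR, realCfc_id hR]
    rfl
  have e1 : regularizedGroup R a t χ - R χ + (Complex.I * t) • (χ - (a : ℂ) • R χ) =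
      realCfc R f χ := by
    rw [e]
    simp
  rw [e1]
  constructor
  · refine (ContinuousLinearMap.le_opNorm _ _).trans
      (mul_le_mul_of_nonneg_right (norm_realCfc_le (by positivity) fun x hxR => ?_)
        (norm_nonneg _))
    refine (norm_regularizedPhase_sub_le a t x).1.trans
      (mul_le_mul_of_nonneg_right ?_ (abs_nonneg t))
    nlinarith [hx x hxR]
  · have e2 : R (realCfc R f χ) = realCfc R (fun x => (x : ℂ) * f x) χ := by
      rw [realCfc_mul _ _ continuous_ofReal' hfc, realCfc_id hR]
      rfl
    rw [e2]
    refine (ContinuousLinearMap.le_opNorm _ _).trans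
      (mul_le_mul_of_nonneg_right (norm_realCfc_le (by positivity) fun x hxR => ?_)
        (norm_nonneg _))
    refine (norm_regularizedPhase_sub_le a t x).2.trans
      (mul_le_mul_of_nonneg_right ?_ (sq_nonneg t))
    have := pow_le_pow_left₀ (abs_nonneg _) (hx x hxR) 2
    linarith

/-- The orthogonal complement of the range is the kernel of the adjoint, which here is the kernel of
`R`. -/
theorem denseRange_of_injective_of_isSelfAdjoint (hR : IsSelfAdjoint R)
    (hinj : ∀ χ, R χ = 0 → χ = 0) : DenseRange R := by
  have h : (LinearMap.range R.toLinearMap)ᗮ = ⊥ := by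
    rw [Submodule.eq_bot_iff]
    intro χ hχ
    refine hinj χ (ext_inner_left ℂ fun ξ => ?_)
    have := (Submodule.mem_orthogonal _ _).1 hχ (R ξ) ⟨ξ, rfl⟩
    rw [inner_zero_right, ← this, ← ContinuousLinearMap.adjoint_inner_left,
      ← ContinuousLinearMap.star_eq_adjoint, hR.star_eq]
  have := (Submodule.dense_iff_topologicalClosure_eq_top).2
    ((Submodule.topologicalClosure_eq_top_iff).2 h)
  exact this

/-- The unitary `exp(-it(1/R - a))` as a bounded operator. -/
noncomputable def extendedGroup (R : E →L[ℂ] E) (a t : ℝ) : E →L[ℂ] E :=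
  (regularizedGroup R a t).toLinearMap.extendOfNorm R.toLinearMap

theorem extendedGroup_apply (hR : IsSelfAdjoint R) (hd : DenseRange R) (a t : ℝ) (χ : E) :
    extendedGroup R a t (R χ) = regularizedGroup R a t χ :=
  LinearMap.extendOfNorm_eq (f := (regularizedGroup R a t).toLinearMap) (e := R.toLinearMap) hd
    ⟨1, fun x => by simp [norm_regularizedGroup_apply hR]⟩ χ

theorem norm_extendedGroup (hR : IsSelfAdjoint R) (hd : DenseRange R) (a t : ℝ) (ψ : E) :
    ‖extendedGroup R a t ψ‖ = ‖ψ‖ := by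
  refine hd.induction_on (p := fun ψ => ‖extendedGroup R a t ψ‖ = ‖ψ‖) ψ
    (isClosed_eq (by fun_prop) (by fun_prop)) fun χ => ?_
  rw [extendedGroup_apply hR hd, norm_regularizedGroup_apply hR]

theorem extendedGroup_zero (hR : IsSelfAdjoint R) (hd : DenseRange R) (a : ℝ) (ψ : E) :
    extendedGroup R a 0 ψ = ψ := by
  refine hd.induction_on (p := fun ψ => extendedGroup R a 0 ψ = ψ) ψ
    (isClosed_eq (by fun_prop) (by fun_prop)) fun χ => ?_
  rw [extendedGroup_apply hR hd, regularizedGroup_zero hR]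

theorem extendedGroup_add (hR : IsSelfAdjoint R) (hd : DenseRange R) (a s t : ℝ) (ψ : E) :
    extendedGroup R a (s + t) ψ = extendedGroup R a s (extendedGroup R a t ψ) := by
  refine hd.induction_on
    (p := fun ψ => extendedGroup R a (s + t) ψ = extendedGroup R a s (extendedGroup R a t ψ)) ψ
    (isClosed_eq (by fun_prop) (by fun_prop)) fun ξ => ?_
  -- A second passage to the range is needed: each of the two extended operators on the right
  -- consumes one factor of `R`.
  refine hd.induction_on (p := fun ξ => extendedGroup R a (s + t) (R ξ) =
    extendedGroup R a s (extendedGroup R a t (R ξ))) ξ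
    (isClosed_eq (by fun_prop) (by fun_prop)) fun χ => ?_
  have h1 : ∀ r, regularizedGroup R a r (R χ) = R (regularizedGroup R a r χ) := fun r =>
    congrArg (fun S : E →L[ℂ] E => S χ) (regularizedGroup_comm hR a r)
  rw [extendedGroup_apply hR hd, extendedGroup_apply hR hd, h1 t, extendedGroup_apply hR hd,
    h1 (s + t)]
  exact (congrArg (fun S : E →L[ℂ] E => S χ) (regularizedGroup_mul hR a s t)).symm

/-- The group `exp(-it(1/R - a))` of unitary operators. -/
noncomputable def stoneGroup (hR : IsSelfAdjoint R) (hd : DenseRange R) (a t : ℝ) : E ≃ₗᵢ[ℂ] E where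
  toFun := extendedGroup R a t
  invFun := extendedGroup R a (-t)
  map_add' := map_add _
  map_smul' := map_smul _
  left_inv ψ := by
    rw [← extendedGroup_add hR hd, neg_add_cancel, extendedGroup_zero hR hd]
  right_inv ψ := by
    rw [← extendedGroup_add hR hd, add_neg_cancel, extendedGroup_zero hR hd]
  norm_map' ψ := norm_extendedGroup hR hd a t ψ

theorem stoneGroup_apply (hR : IsSelfAdjoint R) (hd : DenseRange R) (a t : ℝ) (ψ : E) :
    stoneGroup hR hd a t ψ = extendedGroup R a t ψ := rfl

/-- The first-order remainder at $R\chi$ is $O(|t|)\|\chi\|$ in general and $O(t^2)$ when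
$\chi=R\xi$. Splitting a general $\chi$ into $R\xi$ and a small rest makes it $o(t)$. -/
theorem hasDerivAt_stoneGroup (hR : IsSelfAdjoint R) (hd : DenseRange R) (a : ℝ) (χ : E) :
    HasDerivAt (fun t => stoneGroup hR hd a t (R χ)) (-(Complex.I • (χ - (a : ℂ) • R χ))) 0 := by
  obtain ⟨C, hC, hCb⟩ := norm_regularizedGroup_sub_le hR a
  rw [hasDerivAt_iff_isLittleO_nhds_zero, Asymptotics.isLittleO_iff]
  intro c hc
  -- The rest $\chi-R\xi$ is to contribute at most $\tfrac c2|t|$; `C + 1` replaces `C`, which may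
  -- vanish.
  obtain ⟨ξ, hξ⟩ := hd.exists_dist_lt χ (ε := c / (2 * (C + 1))) (by positivity)
  rw [dist_eq_norm] at hξ
  have hnhds : ∀ᶠ t : ℝ in 𝓝 0, |t| * (C * ‖ξ‖) < c / 2 := by
    have : Tendsto (fun t : ℝ => |t| * (C * ‖ξ‖)) (𝓝 0) (𝓝 0) := by
      have h : Continuous fun t : ℝ => |t| * (C * ‖ξ‖) := by fun_prop
      simpa using h.tendsto 0
    exact this.eventually (gt_mem_nhds (by positivity))
  filter_upwards [hnhds] with t ht
  set W : E → E := fun χ =>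
    regularizedGroup R a t χ - R χ + (Complex.I * t) • (χ - (a : ℂ) • R χ) with hW
  have e : stoneGroup hR hd a (0 + t) (R χ) - stoneGroup hR hd a 0 (R χ) -
      t • -(Complex.I • (χ - (a : ℂ) • R χ)) = W χ := by
    rw [zero_add, stoneGroup_apply, stoneGroup_apply, extendedGroup_apply hR hd,
      extendedGroup_zero hR hd, hW]
    simp only [smul_neg, sub_neg_eq_add, mul_comm Complex.I, mul_smul, Complex.coe_smul]
  have e2 : W χ = W (χ - R ξ) + R (W ξ) := by
    have h1 : regularizedGroup R a t (R ξ) = R (regularizedGroup R a t ξ) :=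
      congrArg (fun S : E →L[ℂ] E => S ξ) (regularizedGroup_comm hR a t)
    simp only [hW, map_sub, map_add, map_smul, h1]
    module
  rw [e, e2, Real.norm_eq_abs]
  have h1 := (hCb t (χ - R ξ)).1
  have h2 := (hCb t ξ).2
  have h3 : C * |t| * ‖χ - R ξ‖ ≤ c / 2 * |t| := by
    have h4 : C * ‖χ - R ξ‖ ≤ c / 2 := by
      have h5 : (C + 1) * ‖χ - R ξ‖ ≤ (C + 1) * (c / (2 * (C + 1))) :=
        mul_le_mul_of_nonneg_left hξ.le (by positivity)
      have h6 : (C + 1) * (c / (2 * (C + 1))) = c / 2 := by field_simp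
      nlinarith [norm_nonneg (χ - R ξ)]
    nlinarith [abs_nonneg t]
  have h4 : C * t ^ 2 * ‖ξ‖ ≤ c / 2 * |t| := by
    rw [← sq_abs t]
    nlinarith [abs_nonneg t]
  calc ‖W (χ - R ξ) + R (W ξ)‖ ≤ ‖W (χ - R ξ)‖ + ‖R (W ξ)‖ := norm_add_le _ _
    _ ≤ c / 2 * |t| + c / 2 * |t| := add_le_add (h1.trans h3) (h2.trans h4)
    _ = c * |t| := by ring

/-- On the range of `R`, differentiability at $0$ and the group law give continuity at every time.
Density and isometry extend this to all vectors by uniform approximation. -/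
theorem continuous_stoneGroup (hR : IsSelfAdjoint R) (hd : DenseRange R) (a : ℝ) (ψ : E) :
    Continuous fun t => stoneGroup hR hd a t ψ := by
  have hdom : ∀ χ, Continuous fun t => stoneGroup hR hd a t (R χ) := fun χ => by
    refine continuous_iff_continuousAt.2 fun t => ?_
    have h0 : ContinuousAt (fun s => stoneGroup hR hd a s (R χ)) (t - t) := by
      rw [sub_self]
      exact (hasDerivAt_stoneGroup hR hd a χ).continuousAt
    have h1 : ContinuousAt (fun s => stoneGroup hR hd a t (stoneGroup hR hd a (s - t) (R χ))) t :=
      (stoneGroup hR hd a t).continuous.continuousAt.comp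
        (ContinuousAt.comp (f := fun s : ℝ => s - t) h0 (by fun_prop))
    refine h1.congr (Eventually.of_forall fun s => ?_)
    simp only [stoneGroup_apply]
    rw [← extendedGroup_add hR hd, add_sub_cancel]
  refine continuous_of_uniform_approx_of_continuous fun u hu => ?_
  obtain ⟨δ, hδ, hδu⟩ := Metric.mem_uniformity_dist.1 hu
  obtain ⟨χ, hχ⟩ := hd.exists_dist_lt ψ hδ
  refine ⟨_, hdom χ, fun t => hδu ?_⟩
  rwa [LinearIsometryEquiv.dist_map]

/-- Stone's theorem for the operator `A = 1/R - a`. -/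
theorem exists_isUnitaryGroupOf (hR : IsSelfAdjoint R) (hinj : ∀ χ, R χ = 0 → χ = 0) (a : ℝ)
    (A : E →ₗ.[ℂ] E) (hA : ∀ ψ η, (ψ, η) ∈ A.graph ↔ ψ = R (η + (a : ℂ) • ψ)) :
    ∃ U, IsUnitaryGroupOf A U := by
  have hd := denseRange_of_injective_of_isSelfAdjoint hR hinj
  refine ⟨stoneGroup hR hd a, extendedGroup_zero hR hd a, extendedGroup_add hR hd a,
    continuous_stoneGroup hR hd a, fun ψ η => ?_⟩
  rw [hA]
  constructor
  · intro h
    have h1 := hasDerivAt_stoneGroup hR hd a (η + (a : ℂ) • ψ)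
    rw [← h] at h1
    simpa using h1
  · intro h
    -- The generator is no larger than $A$: differentiating $\langle R\chi,U_t\psi\rangle=\langle
    -- U_{-t}R\chi,\psi\rangle$ at $0$ gives $\langle
    -- R\chi,\eta\rangle=\langle\chi-aR\chi,\psi\rangle$ for all $\chi$, which means
    -- $R\eta=\psi-aR\psi$.
    have hadj : ∀ x y, inner ℂ (R x) y = inner ℂ x (R y) := fun x y => by
      rw [← ContinuousLinearMap.adjoint_inner_right, ← ContinuousLinearMap.star_eq_adjoint,
        hR.star_eq]
    have key : ∀ χ, inner ℂ (R χ) η = inner ℂ (χ - (a : ℂ) • R χ) ψ := fun χ => by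
      have h1 := (hasDerivAt_const (0 : ℝ) (R χ)).inner ℂ h
      have h2' : HasDerivAt (fun t : ℝ => stoneGroup hR hd a (-t) (R χ))
          (-(-(Complex.I • (χ - (a : ℂ) • R χ)))) 0 := by
        have h3 := hasDerivAt_stoneGroup hR hd a χ
        rw [← neg_zero] at h3
        simpa [Function.comp_def] using h3.scomp (0 : ℝ) (hasDerivAt_neg (0 : ℝ))
      have h2 := h2'.inner ℂ (hasDerivAt_const (0 : ℝ) ψ)
      have e : (fun t => inner ℂ (R χ) (stoneGroup hR hd a t ψ)) =
          fun t => inner ℂ (stoneGroup hR hd a (-t) (R χ)) ψ := funext fun t => by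
        rw [← LinearIsometryEquiv.inner_map_map (stoneGroup hR hd a t)
          (stoneGroup hR hd a (-t) (R χ))]
        simp only [stoneGroup_apply]
        rw [← extendedGroup_add hR hd, add_neg_cancel, extendedGroup_zero hR hd]
      rw [e] at h1
      have h4 := h1.unique h2
      simp only [inner_zero_left, add_zero, inner_zero_right, zero_add, neg_neg, inner_neg_right,
        inner_smul_right, inner_smul_left, Complex.conj_I] at h4
      have h5 := congrArg (fun z => Complex.I * z) h4
      simp only [mul_neg, neg_mul, ← mul_assoc, Complex.I_mul_I, one_mul, neg_neg] at h5
      exact h5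
    have h2 : R η = ψ - (a : ℂ) • R ψ := ext_inner_left ℂ fun χ => by
      rw [← hadj, key, inner_sub_left, inner_sub_right, inner_smul_left, inner_smul_right, hadj,
        Complex.conj_ofReal]
    rw [map_add, map_smul, h2, sub_add_cancel]

end StoneGroup

/-! ### Self-adjointness of the Hamiltonian -/

/-- Both sides of the defining equation depend continuously on the $L^2$ data as tempered
distributions. -/
theorem isClosed_hasWeakGradient :
    IsClosed {p : L2Plane × (Fin 2 → L2Plane) | HasWeakGradient p.1 p.2} := by
  have : {p : L2Plane × (Fin 2 → L2Plane) | HasWeakGradient p.1 p.2} = ⋂ i : Fin 2,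
      {p : L2Plane × (Fin 2 → L2Plane) |
        LineDeriv.lineDerivOpCLM ℂ 𝓢'(Plane, ℂ) (EuclideanSpace.single i (1 : ℝ) : Plane)
          (Lp.toTemperedDistributionCLM ℂ (volume : Measure Plane) 2 p.1) =
        Lp.toTemperedDistributionCLM ℂ (volume : Measure Plane) 2 (p.2 i)} := by
    ext p
    simp only [mem_ofPred_eq, mem_iInter]
    rfl
  rw [this]
  exact isClosed_iInter fun i => isClosed_eq (by fun_prop) (by fun_prop)

namespace StraightMetricGraph

variable {J : Type*} [Finite J] (Γ : StraightMetricGraph J)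

/-- Multiplication by $d_\Gamma$ is unbounded on $L^2$, so the relation is passed to the limit
pointwise, along a subsequence on which both sequences converge almost everywhere. -/
theorem isClosed_isDistMul : IsClosed {p : L2Plane × L2Plane | Γ.IsDistMul p.1 p.2} := by
  refine IsSeqClosed.isClosed fun u p hu hup => ?_
  have h1 : Tendsto (fun k => (u k).1) atTop (𝓝 p.1) := (continuous_fst.tendsto p).comp hup
  have h2 : Tendsto (fun k => (u k).2) atTop (𝓝 p.2) := (continuous_snd.tendsto p).comp hup
  obtain ⟨κ, hκ, hκ1⟩ := (tendstoInMeasure_of_tendsto_Lp h1).exists_seq_tendsto_ae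
  obtain ⟨ν, hν, hν1⟩ := (tendstoInMeasure_of_tendsto_Lp
    (h2.comp hκ.tendsto_atTop)).exists_seq_tendsto_ae
  have hall : ∀ᵐ q, ∀ k, (u k).2 q = (Γ.distTo q : ℂ) * (u k).1 q := ae_all_iff.2 hu
  filter_upwards [hκ1, hν1, hall] with q a b c
  refine tendsto_nhds_unique b ?_
  have := (a.comp hν.tendsto_atTop).const_mul (Γ.distTo q : ℂ)
  refine this.congr fun k => ?_
  exact (c _).symm

theorem IsDistMul.add {ψ w ψ' w' : L2Plane} (h : Γ.IsDistMul ψ w) (h' : Γ.IsDistMul ψ' w') :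
    Γ.IsDistMul (ψ + ψ') (w + w') := by
  filter_upwards [h, h', Lp.coeFn_add w w', Lp.coeFn_add ψ ψ'] with q h1 h2 h3 h4
  rw [h3, h4, Pi.add_apply, Pi.add_apply, h1, h2]
  ring

theorem IsDistMul.smul (c : ℂ) {ψ w : L2Plane} (h : Γ.IsDistMul ψ w) :
    Γ.IsDistMul (c • ψ) (c • w) := by
  filter_upwards [h, Lp.coeFn_smul c w, Lp.coeFn_smul c ψ] with q h1 h3 h4
  rw [h3, h4, Pi.smul_apply, Pi.smul_apply, h1, smul_eq_mul, smul_eq_mul]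
  ring

theorem IsDistMul.zero : Γ.IsDistMul 0 0 := by
  filter_upwards [Lp.coeFn_zero ℂ 2 (volume : Measure Plane)] with q hq
  simp only [hq, Pi.zero_apply, mul_zero]

/-- The form domain, realized as a subspace of `L²(ℝ²)⁴` whose norm is the form norm. -/
def formSpace (ε : ℝ) : Submodule ℂ (PiLp 2 fun _ : Fin 4 => L2Plane) where
  -- The entries are $\psi,\ \nabla\psi/\sqrt2,\ d_\Gamma\psi/(\sqrt2\,\varepsilon)$, so the Hilbert
  -- norm squared is
  -- $\|\psi\|^2+\tfrac12\|\nabla\psi\|^2+\tfrac1{2\varepsilon^2}\|d_\Gamma\psi\|^2$.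
  carrier := {v | HasWeakGradient (v 0) ![((√2 : ℝ) : ℂ) • v 1, ((√2 : ℝ) : ℂ) • v 2] ∧
    Γ.IsDistMul (v 0) (((√2 * ε : ℝ) : ℂ) • v 3)}
  zero_mem' := by
    refine ⟨?_, ?_⟩
    · convert! HasWeakGradient.zero using 1
      ext1 i
      fin_cases i <;> simp
    · convert! IsDistMul.zero Γ using 1
      simp
  add_mem' := by
    rintro v v' ⟨h1, h2⟩ ⟨h1', h2'⟩
    refine ⟨?_, ?_⟩
    · convert! h1.add h1' using 1
      ext1 i
      fin_cases i <;> simp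
    · convert! h2.add Γ h2' using 1
      simp
  smul_mem' := by
    rintro c v ⟨h1, h2⟩
    refine ⟨?_, ?_⟩
    · convert! h1.smul c using 1
      ext1 i
      fin_cases i <;> simpa using smul_comm _ _ _
    · convert! h2.smul Γ c using 1
      exact smul_comm ((√2 * ε : ℝ) : ℂ) c (v 3)

theorem mem_formSpace {ε : ℝ} {v : PiLp 2 fun _ : Fin 4 => L2Plane} : v ∈ Γ.formSpace ε ↔
    HasWeakGradient (v 0) ![((√2 : ℝ) : ℂ) • v 1, ((√2 : ℝ) : ℂ) • v 2] ∧
    Γ.IsDistMul (v 0) (((√2 * ε : ℝ) : ℂ) • v 3) := Iff.rfl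

theorem isClosed_formSpace (ε : ℝ) : IsClosed (Γ.formSpace ε : Set (PiLp 2 fun _ : Fin 4 => L2Plane)) := by
  have hc : ∀ (i : Fin 4) (c : ℂ), Continuous fun v : PiLp 2 fun _ : Fin 4 => L2Plane => c • v i :=
    fun i c => (PiLp.continuous_apply 2 (fun _ : Fin 4 => L2Plane) i).const_smul c
  have h1 : Continuous fun v : PiLp 2 fun _ : Fin 4 => L2Plane =>
      (v 0, ![((√2 : ℝ) : ℂ) • v 1, ((√2 : ℝ) : ℂ) • v 2]) := by
    refine Continuous.prodMk (by fun_prop) (continuous_pi fun i => ?_)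
    fin_cases i
    · exact hc 1 _
    · exact hc 2 _
  have h2 : Continuous fun v : PiLp 2 fun _ : Fin 4 => L2Plane =>
      (v 0, ((√2 * ε : ℝ) : ℂ) • v 3) := Continuous.prodMk (by fun_prop) (hc 3 _)
  exact (isClosed_hasWeakGradient.preimage h1).inter (Γ.isClosed_isDistMul.preimage h2)

instance (ε : ℝ) : CompleteSpace (Γ.formSpace ε) := (Γ.isClosed_formSpace ε).completeSpace_coe

/-- The inclusion of the form domain in `L²(ℝ²)`. -/
noncomputable def formInclusion (ε : ℝ) : Γ.formSpace ε →L[ℂ] L2Plane :=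
  (PiLp.proj 2 (fun _ : Fin 4 => L2Plane) (0 : Fin 4) : (PiLp 2 fun _ : Fin 4 => L2Plane) →L[ℂ] _)
    ∘L (Γ.formSpace ε).subtypeL

/-- The resolvent `(Ĥ(ε) + 1)⁻¹`. -/
noncomputable def resolvent (ε : ℝ) : L2Plane →L[ℂ] L2Plane :=
  Γ.formInclusion ε ∘L (ContinuousLinearMap.adjoint (Γ.formInclusion ε))

theorem isSelfAdjoint_resolvent (ε : ℝ) : IsSelfAdjoint (Γ.resolvent ε) := by
  rw [ContinuousLinearMap.isSelfAdjoint_iff', resolvent, ContinuousLinearMap.adjoint_comp,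
    ContinuousLinearMap.adjoint_adjoint]

/-- Adding $\langle\varphi,\psi\rangle$ to both sides of the form identity makes its left side the
inner product of the form space. The identity then says that $\psi$, as an element of that space,
equals $\iota^*(\eta+\psi)$. -/
theorem mem_hamiltonianGraph_iff {ε : ℝ} (hε : 0 < ε) (ψ η : L2Plane) :
    (ψ, η) ∈ Γ.hamiltonianGraph ε ↔ ψ = Γ.resolvent ε (η + ψ) := by
  have hα : ((√2 : ℝ) : ℂ) ≠ 0 := by simp
  have hβ : ((√2 * ε : ℝ) : ℂ) ≠ 0 := by simp [hε.ne']
  have hα2 : ((√2 : ℝ) : ℂ) * ((√2 : ℝ) : ℂ) = 2 := by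
    rw [← Complex.ofReal_mul, Real.mul_self_sqrt (by norm_num)]; norm_num
  have hβ2 : ((√2 * ε : ℝ) : ℂ) * ((√2 * ε : ℝ) : ℂ) = 2 * (ε : ℂ) ^ 2 := by
    push_cast
    linear_combination (ε : ℂ) ^ 2 * hα2
  have hinner : ∀ u v : PiLp 2 fun _ : Fin 4 => L2Plane, inner ℂ u v =
      inner ℂ (u 0) (v 0) + (1 / 2 : ℂ) * ∑ i,
        inner ℂ ((![((√2 : ℝ) : ℂ) • u 1, ((√2 : ℝ) : ℂ) • u 2] : Fin 2 → L2Plane) i)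
          ((![((√2 : ℝ) : ℂ) • v 1, ((√2 : ℝ) : ℂ) • v 2] : Fin 2 → L2Plane) i) +
        (1 / (2 * (ε : ℂ) ^ 2)) * inner ℂ (((√2 * ε : ℝ) : ℂ) • u 3) (((√2 * ε : ℝ) : ℂ) • v 3) := by
    intro u v
    have h2 : (1 / (2 * (ε : ℂ) ^ 2)) * (2 * (ε : ℂ) ^ 2) = 1 := by
      rw [← hβ2]; field_simp
    rw [PiLp.inner_apply, Fin.sum_univ_four]
    simp only [Fin.sum_univ_two, Matrix.cons_val_zero, Matrix.cons_val_one, inner_smul_left, 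
      inner_smul_right, Complex.conj_ofReal]
    linear_combination (-(inner ℂ (u 1) (v 1)) / 2 - inner ℂ (u 2) (v 2) / 2) * hα2 -
      (inner ℂ (u 3) (v 3)) * h2 - (inner ℂ (u 3) (v 3)) * (1 / (2 * (ε : ℂ) ^ 2)) * hβ2
  have hlift : ∀ (φ : L2Plane) (h : Fin 2 → L2Plane) (w : L2Plane), HasWeakGradient φ h →
      Γ.IsDistMul φ w → ∃ u : Γ.formSpace ε, u.1 0 = φ ∧
        ![((√2 : ℝ) : ℂ) • u.1 1, ((√2 : ℝ) : ℂ) • u.1 2] = h ∧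
        ((√2 * ε : ℝ) : ℂ) • u.1 3 = w := by
    intro φ h w hh hw
    set u : PiLp 2 fun _ : Fin 4 => L2Plane := WithLp.toLp 2
      ![φ, ((√2 : ℝ) : ℂ)⁻¹ • h 0, ((√2 : ℝ) : ℂ)⁻¹ • h 1, ((√2 * ε : ℝ) : ℂ)⁻¹ • w] with hu
    have e0 : u 0 = φ := rfl
    have e1 : ![((√2 : ℝ) : ℂ) • u 1, ((√2 : ℝ) : ℂ) • u 2] = h := by
      ext1 i
      fin_cases i
      · exact smul_inv_smul₀ hα _
      · exact smul_inv_smul₀ hα _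
    have e2 : ((√2 * ε : ℝ) : ℂ) • u 3 = w := smul_inv_smul₀ hβ _
    refine ⟨⟨u, ?_⟩, e0, e1, e2⟩
    rw [mem_formSpace, e0, e1, e2]
    exact ⟨hh, hw⟩
  have hι : ∀ u : Γ.formSpace ε, Γ.formInclusion ε u = u.1 0 := fun u => rfl
  constructor
  · rintro ⟨g, w, hg, hw, hq⟩
    obtain ⟨v, rfl, rfl, rfl⟩ := hlift ψ g w hg hw
    have : v = ContinuousLinearMap.adjoint (Γ.formInclusion ε) (η + v.1 0) := by
      refine ext_inner_left ℂ fun u => ?_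
      obtain ⟨hu1, hu2⟩ := Γ.mem_formSpace.1 u.2
      have := hq _ _ _ hu1 hu2
      rw [ContinuousLinearMap.adjoint_inner_right, hι, inner_add_right, ← this,
        Submodule.coe_inner, hinner]
      ring
    rw [resolvent, ContinuousLinearMap.comp_apply, ← this, hι]
  · intro h
    set v := ContinuousLinearMap.adjoint (Γ.formInclusion ε) (η + ψ) with hv
    have h0 : ψ = v.1 0 := h
    obtain ⟨hv1, hv2⟩ := Γ.mem_formSpace.1 v.2
    refine ⟨_, _, by rw [h0]; exact hv1, by rw [h0]; exact hv2, fun φ hh w hφ hw => ?_⟩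
    obtain ⟨u, rfl, rfl, rfl⟩ := hlift φ hh w hφ hw
    have h3 : inner ℂ u v = inner ℂ (u.1 0) (η + ψ) := by
      rw [hv, ContinuousLinearMap.adjoint_inner_right, hι]
    rw [Submodule.coe_inner, hinner, inner_add_right, h0] at h3
    simp only
    linear_combination h3

/-- A kernel vector $\chi$ would put $(0,\chi)$ in the graph of the Hamiltonian, which is
single-valued because the form domain is dense. -/
theorem resolvent_injective {ε : ℝ} (hε : 0 < ε) (χ : L2Plane) (h : Γ.resolvent ε χ = 0) :
    χ = 0 := by
  have h1 : ((0 : L2Plane), χ) ∈ Γ.hamiltonianGraph ε := by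
    rw [Γ.mem_hamiltonianGraph_iff hε, add_zero, h]
  exact Γ.hamiltonianGraph_unique ε _ h1 rfl

theorem mem_graph_shiftedHamiltonian (n : ℕ) (ε : ℝ) (ψ η : L2Plane) :
    (ψ, η) ∈ (Γ.shiftedHamiltonian n ε).graph ↔
      (ψ, η + ((modeEnergy n / ε : ℝ) : ℂ) • ψ) ∈ Γ.hamiltonianGraph ε := by
  rw [← Γ.graph_hamiltonian, LinearPMap.mem_graph_iff, LinearPMap.mem_graph_iff]
  have e : ∀ y, Γ.shiftedHamiltonian n ε y =
      (-((modeEnergy n / ε : ℝ) : ℂ)) • (y : L2Plane) + Γ.hamiltonian ε y :=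
    fun y => LinearPMap.vadd_apply _ _ y
  constructor
  · rintro ⟨y, rfl, h⟩
    refine ⟨y, rfl, ?_⟩
    simp only at h
    rw [← h, e]
    simp
  · rintro ⟨y, rfl, h⟩
    refine ⟨y, rfl, (e y).trans ?_⟩
    simp only at h
    rw [h]
    simp

theorem isUnitaryGroupOf_expNegI (n : ℕ) {ε : ℝ} (hε : 0 < ε) :
    IsUnitaryGroupOf (Γ.shiftedHamiltonian n ε) (expNegI (Γ.shiftedHamiltonian n ε)) := by
  have h : ∃ U, IsUnitaryGroupOf (Γ.shiftedHamiltonian n ε) U := by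
    refine exists_isUnitaryGroupOf (Γ.isSelfAdjoint_resolvent ε) (Γ.resolvent_injective hε)
      -- The shift is $a=E_n/\varepsilon+1$, since $\widetilde H=R^{-1}-1-E_n/\varepsilon$.
      (modeEnergy n / ε + 1) _ fun ψ η => ?_
    rw [Γ.mem_graph_shiftedHamiltonian, Γ.mem_hamiltonianGraph_iff hε]
    push_cast
    rw [add_smul, one_smul, add_assoc]
  rw [expNegI, dif_pos h]
  exact h.choose_spec

end StraightMetricGraph

/-! ### The transverse modes are Schwartz functions -/

theorem Polynomial.derivative_hermite_succ (n : ℕ) :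
    Polynomial.derivative (Polynomial.hermite (n + 1)) =
      ((n : Polynomial ℤ) + 1) * Polynomial.hermite n := by
  induction n with
  | zero => simp
  | succ n ih =>
    have h := Polynomial.hermite_succ n
    rw [Polynomial.hermite_succ (n + 1), map_sub, Polynomial.derivative_mul,
      Polynomial.derivative_X, ih, Polynomial.derivative_mul, h]
    simp only [map_add, Polynomial.derivative_natCast, Polynomial.derivative_one]
    push_cast
    ring

/-- Hermite's differential equation. -/
theorem Polynomial.derivative_derivative_hermite (n : ℕ) :
    Polynomial.derivative (Polynomial.derivative (Polynomial.hermite n)) =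
      Polynomial.X * Polynomial.derivative (Polynomial.hermite n) -
        (n : Polynomial ℤ) * Polynomial.hermite n := by
  have h := congrArg Polynomial.derivative (Polynomial.hermite_succ n)
  rw [Polynomial.derivative_hermite_succ, map_sub, Polynomial.derivative_mul,
    Polynomial.derivative_X] at h
  linear_combination h

/-- Monomials suffice: $|x|^k\le1+x^{2k}$, and $e^{x^2/2}$ dominates both $1$ and $(x^2/2)^k/k!$. -/
theorem exists_bound_polynomial_mul_gaussian (P : Polynomial ℝ) :
    ∃ C, ∀ x : ℝ, |P.eval x * Real.exp (-(x ^ 2 / 2))| ≤ C := by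
  induction P using Polynomial.induction_on' with
  | add p q hp hq =>
    obtain ⟨C, hC⟩ := hp
    obtain ⟨D, hD⟩ := hq
    refine ⟨C + D, fun x => ?_⟩
    rw [Polynomial.eval_add, add_mul]
    exact (abs_add_le _ _).trans (add_le_add (hC x) (hD x))
  | monomial k a =>
    refine ⟨|a| * (1 + 2 ^ k * k.factorial), fun x => ?_⟩
    have h1 := Real.pow_div_factorial_le_exp (x ^ 2 / 2) (by positivity) k
    have h2 : (x ^ 2) ^ k ≤ 2 ^ k * k.factorial * Real.exp (x ^ 2 / 2) := by
      rw [div_le_iff₀ (by positivity), div_pow, div_le_iff₀ (by positivity)] at h1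
      linarith
    have h3 : |x| ^ k ≤ 1 + (x ^ 2) ^ k := by
      rw [← sq_abs x, ← pow_mul, mul_comm 2 k, pow_mul]
      nlinarith [sq_nonneg (|x| ^ k - 1)]
    have h4 : (1 : ℝ) ≤ Real.exp (x ^ 2 / 2) := Real.one_le_exp (by positivity)
    rw [Polynomial.eval_monomial, abs_mul, abs_mul, abs_pow, Real.abs_exp, Real.exp_neg,
      ← div_eq_mul_inv, div_le_iff₀ (Real.exp_pos _), mul_assoc]
    refine mul_le_mul_of_nonneg_left ?_ (abs_nonneg a)
    linarith

/-- The Gaussian `exp(-x²/2)` as a Schwartz function. -/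
noncomputable def gaussianSchwartz : 𝓢(ℝ, ℝ) where
  toFun x := Real.exp (-(x ^ 2 / 2))
  smooth' := by fun_prop
  decay' k n := by
    -- The $n$-th derivative of the Gaussian is, up to sign, $He_n$ times the Gaussian.
    obtain ⟨C, hC⟩ := exists_bound_polynomial_mul_gaussian
      (Polynomial.X ^ k * (Polynomial.hermite n).map (Int.castRingHom ℝ))
    refine ⟨C, fun x => ?_⟩
    refine le_trans (le_of_eq ?_) (hC x)
    rw [norm_iteratedFDeriv_eq_norm_iteratedDeriv, iteratedDeriv_eq_iterate,
      Polynomial.deriv_gaussian_eq_hermite_mul_gaussian, Polynomial.eval_mul,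
      Polynomial.eval_map, Polynomial.aeval_def]
    simp [abs_mul, mul_assoc]

theorem gaussianSchwartz_apply (x : ℝ) : gaussianSchwartz x = Real.exp (-(x ^ 2 / 2)) := rfl

theorem Polynomial.hasTemperateGrowth_eval (P : Polynomial ℝ) :
    Function.HasTemperateGrowth fun x : ℝ => P.eval x := by
  induction P using Polynomial.induction_on' with
  | add p q hp hq =>
    simp only [Polynomial.eval_add]
    exact hp.add hq
  | monomial k a =>
    simp only [Polynomial.eval_monomial]
    exact (Function.HasTemperateGrowth.const a).mul (Function.HasTemperateGrowth.id'.pow k)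

/-- The polynomial factor of the transverse mode. -/
noncomputable def modePolynomial (n : ℕ) (ε : ℝ) : Polynomial ℝ :=
  Polynomial.C ((Real.pi * ε) ^ (-(1 / 4) : ℝ) * (Real.sqrt (Nat.factorial n))⁻¹) *
    ((Polynomial.hermite n).map (Int.castRingHom ℝ)).comp
      (Polynomial.C (Real.sqrt 2 / Real.sqrt ε) * Polynomial.X)

theorem transverseMode_eq (n : ℕ) {ε : ℝ} (hε : 0 < ε) (y : ℝ) :
    transverseMode n ε y =
      (modePolynomial n ε).eval y * Real.exp (-(((Real.sqrt ε)⁻¹ * y) ^ 2 / 2)) := by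
  have h1 : ((Real.sqrt ε)⁻¹ * y) ^ 2 / 2 = y ^ 2 / (2 * ε) := by
    rw [mul_pow, inv_pow, Real.sq_sqrt hε.le]
    field_simp
  rw [transverseMode, h1, modePolynomial, Polynomial.eval_mul, Polynomial.eval_C,
    Polynomial.eval_comp, Polynomial.eval_map, Polynomial.aeval_def, Polynomial.eval_mul,
    Polynomial.eval_C, Polynomial.eval_X, mul_div_right_comm]
  rfl

/-- The transverse mode as a Schwartz function. -/
noncomputable def modeSchwartz (n : ℕ) {ε : ℝ} (hε : 0 < ε) : 𝓢(ℝ, ℂ) :=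
  SchwartzMap.postcompCLM (𝕜 := ℝ) Complex.ofRealCLM
    (SchwartzMap.smulLeftCLM ℝ (fun y => (modePolynomial n ε).eval y)
      (SchwartzMap.compCLMOfContinuousLinearEquiv ℝ
        (ContinuousLinearEquiv.unitsEquivAut ℝ (Units.mk0 (Real.sqrt ε)⁻¹
          (inv_ne_zero (Real.sqrt_pos.2 hε).ne'))) gaussianSchwartz))

theorem modeSchwartz_apply (n : ℕ) {ε : ℝ} (hε : 0 < ε) (y : ℝ) :
    modeSchwartz n hε y = (transverseMode n ε y : ℂ) := by
  rw [modeSchwartz, SchwartzMap.postcompCLM_apply, SchwartzMap.smulLeftCLM_apply_apply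
    (Polynomial.hasTemperateGrowth_eval _), transverseMode_eq n hε]
  simp [gaussianSchwartz_apply, mul_comm]

/-- The eigenvalue equation of the harmonic oscillator. -/
theorem deriv_deriv_transverseMode (n : ℕ) {ε : ℝ} (hε : 0 < ε) (y : ℝ) :
    deriv (deriv (transverseMode n ε)) y =
      (y ^ 2 / ε ^ 2 - 2 * (modeEnergy n / ε)) * transverseMode n ε y := by
  set c : ℝ := (Real.pi * ε) ^ (-(1 / 4) : ℝ) * (Real.sqrt (Nat.factorial n))⁻¹ with hc
  set β : ℝ := Real.sqrt 2 / Real.sqrt ε with hβ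
  have hβ2 : β ^ 2 = 2 / ε := by
    rw [hβ, div_pow, Real.sq_sqrt (by norm_num), Real.sq_sqrt hε.le]
  have hP : ∀ (P : Polynomial ℤ) (y : ℝ), HasDerivAt (fun y => Polynomial.aeval (β * y) P)
      (β * Polynomial.aeval (β * y) (Polynomial.derivative P)) y := fun P y => by
    have h1 := (Polynomial.hasDerivAt_aeval P (β * y)).comp y ((hasDerivAt_id y).const_mul β)
    rw [mul_comm]
    simpa [Function.comp_def] using h1
  have hE : ∀ y : ℝ, HasDerivAt (fun y => Real.exp (-(y ^ 2 / (2 * ε))))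
      (-(y / ε) * Real.exp (-(y ^ 2 / (2 * ε)))) y := fun y => by
    have h1 := (((hasDerivAt_pow 2 y).div_const (2 * ε)).neg).exp
    convert! h1 using 1
    field_simp
    simp
    ring
  have hΦ : transverseMode n ε = fun y => c * Polynomial.aeval (β * y) (Polynomial.hermite n) *
      Real.exp (-(y ^ 2 / (2 * ε))) := by
    ext y
    rw [transverseMode, hβ, mul_div_right_comm]
  have h1 : deriv (transverseMode n ε) = fun y =>
      c * (β * Polynomial.aeval (β * y) (Polynomial.derivative (Polynomial.hermite n))) *
        Real.exp (-(y ^ 2 / (2 * ε))) +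
      c * Polynomial.aeval (β * y) (Polynomial.hermite n) *
        (-(y / ε) * Real.exp (-(y ^ 2 / (2 * ε)))) := by
    ext y
    rw [hΦ]
    exact (((hP _ y).const_mul c).mul (hE y)).deriv
  rw [h1]
  have h2 := (((((hP (Polynomial.derivative (Polynomial.hermite n)) y).const_mul β).const_mul
    c).mul (hE y)).add (((hP (Polynomial.hermite n) y).const_mul c).mul
      ((((hasDerivAt_id y).div_const ε).neg).mul (hE y)))).deriv
  refine Eq.trans h2 ?_
  have h3 := congrArg (Polynomial.aeval (β * y)) (Polynomial.derivative_derivative_hermite n)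
  rw [map_sub, map_mul, map_mul, Polynomial.aeval_X, map_natCast] at h3
  rw [h3, hΦ]
  simp only [id, modeEnergy, Pi.mul_apply, Pi.neg_apply]
  set H := Polynomial.aeval (β * y) (Polynomial.hermite n)
  set H' := Polynomial.aeval (β * y) (Polynomial.derivative (Polynomial.hermite n))
  set e := Real.exp (-(y ^ 2 / (2 * ε)))
  have h4 : y ^ 2 / ε ^ 2 = (y / ε) ^ 2 := by ring
  have h5 : (β ^ 2 * y) = 2 * (y / ε) := by rw [hβ2]; ring
  rw [h4]
  clear_value β c
  linear_combination (c * β * H' * e) * h5 - (c * n * H * e) * hβ2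

/-- The second derivative of the transverse mode, as a Schwartz function. -/
theorem deriv_deriv_modeSchwartz (n : ℕ) {ε : ℝ} (hε : 0 < ε) (y : ℝ) :
    deriv (deriv (modeSchwartz n hε)) y =
      (((y ^ 2 / ε ^ 2 - 2 * (modeEnergy n / ε)) : ℝ) : ℂ) * modeSchwartz n hε y := by
  have h0 : (modeSchwartz n hε : ℝ → ℂ) = fun y => (transverseMode n ε y : ℂ) :=
    funext fun y => modeSchwartz_apply n hε y
  have hd : ∀ g : ℝ → ℝ, deriv (fun y => (g y : ℂ)) = fun y => ((deriv g y : ℝ) : ℂ) := fun g => by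
    ext y
    by_cases hg : DifferentiableAt ℝ g y
    · exact hg.hasDerivAt.ofReal_comp.deriv
    · rw [deriv_zero_of_not_differentiableAt hg, deriv_zero_of_not_differentiableAt]
      · simp
      · intro h
        exact hg (by simpa [Function.comp_def] using! Complex.reCLM.differentiableAt.comp y h)
  rw [h0, hd, hd]
  simp only
  rw [deriv_deriv_transverseMode n hε]
  push_cast
  rfl

/-! ### Products of Schwartz functions of the edge coordinates -/

theorem SchwartzMap.exists_bound_one_add_pow_mul {F : Type*} [NormedAddCommGroup F]
    [NormedSpace ℝ F] (a : 𝓢(ℝ, F)) (k n : ℕ) :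
    ∃ C : ℝ, 0 ≤ C ∧ ∀ x, (1 + |x|) ^ k * ‖iteratedFDeriv ℝ n a x‖ ≤ C :=
  ⟨2 ^ k * (Finset.Iic (k, n)).sup (fun m => SchwartzMap.seminorm ℝ m.1 m.2) a, by positivity,
    fun x => SchwartzMap.one_add_le_sup_seminorm_apply (m := (k, n)) le_rfl le_rfl a x⟩

/-- The Schwartz function `v ↦ a (X v) b (Y v)`, for linear coordinates `X` and `Y`. -/
noncomputable def SchwartzMap.tensorComp {E : Type*} [NormedAddCommGroup E] [NormedSpace ℝ E]
    (X Y : E →L[ℝ] ℝ) (hXY : ∀ v, ‖v‖ ≤ |X v| + |Y v|) (a b : 𝓢(ℝ, ℂ)) : 𝓢(E, ℂ) where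
  toFun v := a (X v) * b (Y v)
  smooth' := ((a.smooth ⊤).comp X.contDiff).mul ((b.smooth ⊤).comp Y.contDiff)
  decay' k n := by
    choose A hA0 hA using fun i => a.exists_bound_one_add_pow_mul k i
    choose B hB0 hB using fun i => b.exists_bound_one_add_pow_mul k i
    refine ⟨∑ i ∈ Finset.range (n + 1),
      (n.choose i : ℝ) * (A i * ‖X‖ ^ i) * (B (n - i) * ‖Y‖ ^ (n - i)), fun v => ?_⟩
    have hcomp : ∀ (c : 𝓢(ℝ, ℂ)) (Z : E →L[ℝ] ℝ) (i : ℕ),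
        ‖iteratedFDeriv ℝ i (c ∘ Z) v‖ ≤ ‖iteratedFDeriv ℝ i c (Z v)‖ * ‖Z‖ ^ i := by
      intro c Z i
      rw [Z.iteratedFDeriv_comp_right (c.smooth ⊤) v (i := i) (by exact_mod_cast le_top)]
      refine (ContinuousMultilinearMap.norm_compContinuousLinearMap_le _ _).trans (le_of_eq ?_)
      simp
    -- The weight is split as $\|v\|\le(1+|X v|)(1+|Y v|)$, so that each one-variable factor absorbs
    -- its own share.
    have hv : ‖v‖ ^ k ≤ (1 + |X v|) ^ k * (1 + |Y v|) ^ k := by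
      rw [← mul_pow]
      refine pow_le_pow_left₀ (norm_nonneg v) ?_ k
      nlinarith [hXY v, abs_nonneg (X v), abs_nonneg (Y v)]
    have h1 := norm_iteratedFDeriv_mul_le (𝕜 := ℝ) (n := n) (N := ∞) (f := a ∘ X) (g := b ∘ Y)
      ((a.smooth ⊤).comp X.contDiff) ((b.smooth ⊤).comp Y.contDiff) v
      (by exact_mod_cast le_top)
    refine (mul_le_mul hv h1 (norm_nonneg _) (by positivity)).trans ?_
    rw [Finset.mul_sum]
    refine Finset.sum_le_sum fun i _ => ?_
    have h2 : (1 + |X v|) ^ k * ‖iteratedFDeriv ℝ i (a ∘ X) v‖ ≤ A i * ‖X‖ ^ i := by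
      refine (mul_le_mul_of_nonneg_left (hcomp a X i) (by positivity)).trans ?_
      rw [← mul_assoc]
      exact mul_le_mul_of_nonneg_right (hA i _) (by positivity)
    have h3 : (1 + |Y v|) ^ k * ‖iteratedFDeriv ℝ (n - i) (b ∘ Y) v‖ ≤
        B (n - i) * ‖Y‖ ^ (n - i) := by
      refine (mul_le_mul_of_nonneg_left (hcomp b Y _) (by positivity)).trans ?_
      rw [← mul_assoc]
      exact mul_le_mul_of_nonneg_right (hB _ _) (by positivity)
    have h4 := mul_le_mul h2 h3 (by positivity) (mul_nonneg (hA0 i) (by positivity))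
    calc _ = (n.choose i : ℝ) * (((1 + |X v|) ^ k * ‖iteratedFDeriv ℝ i (a ∘ X) v‖) *
          ((1 + |Y v|) ^ k * ‖iteratedFDeriv ℝ (n - i) (b ∘ Y) v‖)) := by ring
      _ ≤ (n.choose i : ℝ) * ((A i * ‖X‖ ^ i) * (B (n - i) * ‖Y‖ ^ (n - i))) :=
        mul_le_mul_of_nonneg_left h4 (by positivity)
      _ = _ := by ring

namespace StraightMetricGraph

variable {J : Type*} [Finite J] (Γ : StraightMetricGraph J)

theorem norm_perp_dir (j : J) : ‖perp (Γ.dir j)‖ = 1 := by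
  have h := Γ.sq_add_sq j
  rw [EuclideanSpace.norm_eq, Real.sqrt_eq_one]
  simp [perp, Fin.sum_univ_two]
  linarith

theorem norm_le_coords (j : J) (v : Plane) :
    ‖v‖ ≤ |innerSL ℝ (Γ.dir j) v| + |innerSL ℝ (perp (Γ.dir j)) v| := by
  have h := Γ.point_coords j (Γ.start j + v)
  have h1 : v = innerSL ℝ (Γ.dir j) v • Γ.dir j +
      innerSL ℝ (perp (Γ.dir j)) v • perp (Γ.dir j) := by
    simp only [point, coords, add_sub_cancel_left, add_assoc] at h
    exact (add_left_cancel h).symm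
  calc ‖v‖ = _ := congrArg norm h1
    _ ≤ _ := norm_add_le _ _
    _ = _ := by rw [norm_smul, norm_smul, Γ.norm_dir, Γ.norm_perp_dir]; simp

/-- The Schwartz function `a(x_j) b(y_j)` on the plane. -/
noncomputable def edgeTensor (j : J) (a b : 𝓢(ℝ, ℂ)) : 𝓢(Plane, ℂ) :=
  SchwartzMap.compSubConstCLM ℂ (Γ.start j) (SchwartzMap.tensorComp (innerSL ℝ (Γ.dir j))
    (innerSL ℝ (perp (Γ.dir j))) (Γ.norm_le_coords j) a b)

theorem edgeTensor_apply (j : J) (a b : 𝓢(ℝ, ℂ)) (q : Plane) :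
    Γ.edgeTensor j a b q = a (Γ.coords j q).1 * b (Γ.coords j q).2 := by
  rw [edgeTensor, SchwartzMap.compSubConstCLM_apply]
  rfl

theorem coords_add_smul (j : J) (q m : Plane) (t : ℝ) :
    Γ.coords j (q + t • m) = ((Γ.coords j q).1 + t * inner ℝ (Γ.dir j) m,
      (Γ.coords j q).2 + t * inner ℝ (perp (Γ.dir j)) m) := by
  simp only [coords, add_sub_right_comm, inner_add_right, inner_smul_right]

theorem lineDeriv_edgeTensor (j : J) (a b : 𝓢(ℝ, ℂ)) (m : Plane) :
    ∂_{m} (Γ.edgeTensor j a b) =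
      inner ℝ (Γ.dir j) m • Γ.edgeTensor j (SchwartzMap.derivCLM ℂ ℂ a) b +
      inner ℝ (perp (Γ.dir j)) m • Γ.edgeTensor j a (SchwartzMap.derivCLM ℂ ℂ b) := by
  ext q
  rw [SchwartzMap.lineDerivOp_apply]
  refine HasLineDerivAt.lineDeriv ?_
  rw [HasLineDerivAt]
  simp only [edgeTensor_apply, coords_add_smul, add_apply, smul_apply,
    SchwartzMap.derivCLM_apply]
  have hc : ∀ (c : 𝓢(ℝ, ℂ)) (x s : ℝ), HasDerivAt (fun t : ℝ => c (x + t * s)) (s • deriv c x) 0 :=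
    fun c x s => by
      have h1 : HasDerivAt (fun t : ℝ => x + t * s) s 0 := by
        simpa using ((hasDerivAt_id (0 : ℝ)).mul_const s).const_add x
      have h2 : HasDerivAt c (deriv c x) (x + 0 * s) := by simpa using c.hasDerivAt x
      exact h2.scomp (0 : ℝ) h1
  have := (hc a (Γ.coords j q).1 (inner ℝ (Γ.dir j) m)).mul
    (hc b (Γ.coords j q).2 (inner ℝ (perp (Γ.dir j)) m))
  convert! this using 1
  simp
  ring

theorem inner_dir_dir (j : J) : inner ℝ (Γ.dir j) (Γ.dir j) = 1 := by
  rw [real_inner_self_eq_norm_sq, Γ.norm_dir, one_pow]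

theorem inner_perp_perp (j : J) : inner ℝ (perp (Γ.dir j)) (perp (Γ.dir j)) = 1 := by
  rw [real_inner_self_eq_norm_sq, Γ.norm_perp_dir, one_pow]

theorem inner_dir_perp (j : J) : inner ℝ (Γ.dir j) (perp (Γ.dir j)) = 0 := by
  simp [perp, PiLp.inner_apply, Fin.sum_univ_two]
  ring

theorem orthonormal_frame (j : J) : Orthonormal ℝ ![Γ.dir j, perp (Γ.dir j)] := by
  rw [orthonormal_iff_ite]
  intro a b
  fin_cases a <;> fin_cases b <;>
    simp [-inner_self_eq_norm_sq_to_K, Γ.inner_dir_dir, Γ.inner_dir_perp, Γ.inner_perp_perp,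
      real_inner_comm (Γ.dir j) (perp (Γ.dir j))]

-- The Laplacian can be computed in any orthonormal basis; in the frame of the edge the mixed terms
-- vanish.
open Laplacian in
theorem laplacian_edgeTensor (j : J) (a b : 𝓢(ℝ, ℂ)) : Δ (Γ.edgeTensor j a b) =
    Γ.edgeTensor j (SchwartzMap.derivCLM ℂ ℂ (SchwartzMap.derivCLM ℂ ℂ a)) b +
    Γ.edgeTensor j a (SchwartzMap.derivCLM ℂ ℂ (SchwartzMap.derivCLM ℂ ℂ b)) := by
  have hon := Γ.orthonormal_frame j
  have hsp := hon.linearIndependent.span_eq_top_of_card_eq_finrank' (by simp)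
  rw [SchwartzMap.laplacian_eq_sum (OrthonormalBasis.mk hon hsp.ge), Fin.sum_univ_two]
  simp only [OrthonormalBasis.coe_mk, Matrix.cons_val_zero, Matrix.cons_val_one,
    lineDeriv_edgeTensor, Γ.inner_dir_dir, Γ.inner_dir_perp, Γ.inner_perp_perp,
    real_inner_comm (Γ.dir j) (perp (Γ.dir j)), zero_smul, one_smul, add_zero, zero_add]

/-! ### The transverse lift and the projection -/

theorem memLp_lift (j : J) (n : ℕ) {ε : ℝ} (hε : 0 < ε) (θ : L2Line) :
    MemLp (fun q : Plane => θ (Γ.coords j q).1 * (transverseMode n ε (Γ.coords j q).2 : ℂ)) 2 := by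
  have h1 := Lp.memLp θ
  have h2 := memLp_transverseMode n hε
  have h : MemLp (fun z : ℝ × ℝ => θ z.1 * (transverseMode n ε z.2 : ℂ)) 2 := by
    have hm : AEStronglyMeasurable (fun z : ℝ × ℝ => θ z.1 * (transverseMode n ε z.2 : ℂ))
        (volume.prod volume) := h1.1.comp_fst.mul h2.1.comp_snd
    refine (memLp_two_iff_integrable_sq_norm hm).2 ?_
    have := h1.integrable_norm_pow two_ne_zero |>.mul_prod (h2.integrable_norm_pow two_ne_zero)
    simpa [mul_pow] using! this
  exact h.comp_measurePreserving (Γ.measurePreserving_coords j)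

theorem ae_coords_fst (j : J) {p : ℝ → Prop} (h : ∀ᵐ x, p x) :
    ∀ᵐ q, p (Γ.coords j q).1 :=
  (Measure.quasiMeasurePreserving_fst.comp
    (Γ.measurePreserving_coords j).quasiMeasurePreserving).ae h

theorem integral_coords {F : Type*} [NormedAddCommGroup F] [NormedSpace ℝ F]
    (j : J) (G : ℝ × ℝ → F) : ∫ q, G (Γ.coords j q) = ∫ z, G z := by
  refine (Γ.measurePreserving_coords j).integral_comp ?_ G
  exact ((Homeomorph.mk ⟨Γ.coords j, Γ.point j, Γ.point_coords j, Γ.coords_point j⟩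
    (Γ.continuous_coords j) (Γ.continuous_point j)) : Plane ≃ₜ ℝ × ℝ).measurableEmbedding

theorem L2_norm_sq_eq {α : Type*} [MeasurableSpace α] {μ : Measure α} (f : Lp ℂ 2 μ) :
    ‖f‖ ^ 2 = ∫ x, ‖f x‖ ^ 2 ∂μ := by
  have h := L2.inner_def (𝕜 := ℂ) f f
  rw [inner_self_eq_norm_sq_to_K] at h
  have h2 : ∀ x, inner ℂ (f x) (f x) = ((‖f x‖ ^ 2 : ℝ) : ℂ) := fun x => by
    rw [inner_self_eq_norm_sq_to_K]
    push_cast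
    rfl
  simp_rw [h2] at h
  rw [integral_complex_ofReal] at h
  exact Complex.ofReal_injective ((Complex.ofReal_pow _ _).trans h)

/-- The lift `θ ↦ θ(x_j) Φₙ^ε(y_j)`, as a bounded operator from `L²(ℝ)` to `L²(ℝ²)`. -/
noncomputable def lift (j : J) (n : ℕ) {ε : ℝ} (hε : 0 < ε) : L2Line →L[ℂ] L2Plane :=
  LinearMap.mkContinuous
    { toFun := fun θ => (Γ.memLp_lift j n hε θ).toLp
      map_add' := fun θ θ' => by
        rw [← MemLp.toLp_add]
        refine (MemLp.toLp_eq_toLp_iff _ _).2 ?_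
        filter_upwards [Γ.ae_coords_fst j (Lp.coeFn_add θ θ')] with q hq
        rw [hq]
        simp [add_mul]
      map_smul' := fun c θ => by
        rw [RingHom.id_apply, ← MemLp.toLp_const_smul]
        refine (MemLp.toLp_eq_toLp_iff _ _).2 ?_
        filter_upwards [Γ.ae_coords_fst j (Lp.coeFn_smul c θ)] with q hq
        rw [hq]
        simp [mul_assoc] }
    (Real.sqrt (∫ y, transverseMode n ε y ^ 2)) fun θ => by
      refine le_of_eq ((pow_left_inj₀ (norm_nonneg _) (by positivity) two_ne_zero).1 ?_)
      rw [mul_pow, Real.sq_sqrt (integral_nonneg fun y => by positivity), L2_norm_sq_eq,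
        L2_norm_sq_eq]
      have h1 : ∫ q, ‖(Γ.memLp_lift j n hε θ).toLp _ q‖ ^ 2 =
          ∫ q, (fun z : ℝ × ℝ => ‖θ z.1‖ ^ 2 * transverseMode n ε z.2 ^ 2) (Γ.coords j q) := by
        refine integral_congr_ae ?_
        filter_upwards [(Γ.memLp_lift j n hε θ).coeFn_toLp] with q hq
        rw [hq]
        simp [mul_pow]
      refine (h1.trans (Γ.integral_coords j
        (fun z : ℝ × ℝ => ‖θ z.1‖ ^ 2 * transverseMode n ε z.2 ^ 2))).trans ?_
      rw [mul_comm]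
      exact integral_prod_mul (fun x => ‖θ x‖ ^ 2) (fun y => transverseMode n ε y ^ 2)

theorem coeFn_lift (j : J) (n : ℕ) {ε : ℝ} (hε : 0 < ε) (θ : L2Line) :
    ∀ᵐ q, Γ.lift j n hε θ q = θ (Γ.coords j q).1 * (transverseMode n ε (Γ.coords j q).2 : ℂ) :=
  (Γ.memLp_lift j n hε θ).coeFn_toLp

theorem norm_lift_le (j : J) (n : ℕ) {ε : ℝ} (hε : 0 < ε) :
    ‖Γ.lift j n hε‖ ≤ Real.sqrt (∫ y, transverseMode n ε y ^ 2) :=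
  LinearMap.mkContinuous_norm_le _ (Real.sqrt_nonneg _) _

/-- Fubini in the edge coordinates. Linearity, boundedness and continuity of the projection all
follow from this identity. -/
theorem projection_eq_adjoint (j : J) (n : ℕ) {ε : ℝ} (hε : 0 < ε) (ψ : L2Plane) :
    Γ.projection j n hε ψ = ContinuousLinearMap.adjoint (Γ.lift j n hε) ψ := by
  refine ext_inner_left ℂ fun θ => ?_
  rw [ContinuousLinearMap.adjoint_inner_right, L2.inner_def, L2.inner_def]
  have h1 : ∫ q, inner ℂ (Γ.lift j n hε θ q) (ψ q) =
      ∫ q, (fun z : ℝ × ℝ => conj (θ z.1 * (transverseMode n ε z.2 : ℂ)) *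
        ψ (Γ.point j z)) (Γ.coords j q) := by
    refine integral_congr_ae ?_
    filter_upwards [Γ.coeFn_lift j n hε θ] with q hq
    rw [hq, Γ.point_coords, RCLike.inner_apply, mul_comm]
  have hint : Integrable (fun z : ℝ × ℝ => conj (θ z.1 * (transverseMode n ε z.2 : ℂ)) *
        ψ (Γ.point j z)) (volume.prod volume) := by
    have h2 : MemLp (fun z : ℝ × ℝ => conj (θ z.1 * (transverseMode n ε z.2 : ℂ))) 2 := by
      have h3 := (Γ.memLp_lift j n hε θ).comp_measurePreserving (Γ.measurePreserving_point j)
      simp only [Function.comp_def, Γ.coords_point] at h3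
      exact h3.star
    exact h2.integrable_mul ((Lp.memLp ψ).comp_measurePreserving (Γ.measurePreserving_point j))
  refine Eq.trans ?_ (h1.trans ((Γ.integral_coords j (fun z : ℝ × ℝ =>
    conj (θ z.1 * (transverseMode n ε z.2 : ℂ)) * ψ (Γ.point j z))).trans
      (integral_prod _ hint))).symm
  refine integral_congr_ae ?_
  filter_upwards [(Γ.memLp_projection j n hε ψ).coeFn_toLp] with x hx
  rw [projection, hx, RCLike.inner_apply, mul_comm, ← integral_const_mul]
  simp only [map_mul, mul_assoc]

end StraightMetricGraph

/-! ### The Hamiltonian on Schwartz functions -/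

/-- The complex conjugate of a Schwartz function. -/
noncomputable def SchwartzMap.conjMap {E : Type*} [NormedAddCommGroup E] [NormedSpace ℝ E]
    (f : 𝓢(E, ℂ)) : 𝓢(E, ℂ) :=
  SchwartzMap.postcompCLM (𝕜 := ℝ) (Complex.conjCLE : ℂ →L[ℝ] ℂ) f

theorem SchwartzMap.conjMap_apply {E : Type*} [NormedAddCommGroup E] [NormedSpace ℝ E]
    (f : 𝓢(E, ℂ)) (x : E) : f.conjMap x = conj (f x) := rfl

theorem SchwartzMap.lineDerivOp_conjMap {E : Type*} [NormedAddCommGroup E] [NormedSpace ℝ E]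
    (f : 𝓢(E, ℂ)) (m : E) : ∂_{m} f.conjMap = (∂_{m} f).conjMap := by
  ext x
  rw [SchwartzMap.conjMap_apply, SchwartzMap.lineDerivOp_apply_eq_fderiv,
    SchwartzMap.lineDerivOp_apply_eq_fderiv]
  have h : HasFDerivAt f.conjMap ((Complex.conjCLE : ℂ →L[ℝ] ℂ).comp (fderiv ℝ f x)) x :=
    (Complex.conjCLE : ℂ →L[ℝ] ℂ).hasFDerivAt.comp x (f.hasFDerivAt x)
  rw [h.fderiv]
  rfl

/-- The distributional pairing is bilinear while the inner product is conjugate-linear on the left,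
which accounts for the two conjugations. -/
theorem inner_schwartz_toLp (φ : L2Plane) (F : 𝓢(Plane, ℂ)) :
    inner ℂ φ (F.toLp 2 volume) = conj ((φ : 𝓢'(Plane, ℂ)) F.conjMap) := by
  rw [Lp.toTemperedDistribution_apply, L2.inner_def, ← integral_conj]
  refine integral_congr_ae ?_
  filter_upwards [F.coeFn_toLp 2 volume] with q hq
  rw [hq, RCLike.inner_apply, SchwartzMap.conjMap_apply, smul_eq_mul, map_mul, Complex.conj_conj]

/-- Integration by parts against a weak gradient. -/
theorem HasWeakGradient.inner_lineDerivOp {φ : L2Plane} {h : Fin 2 → L2Plane}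
    (hφ : HasWeakGradient φ h) (i : Fin 2) (F : 𝓢(Plane, ℂ)) :
    inner ℂ (h i) (F.toLp 2 volume) =
      -inner ℂ φ ((∂_{(EuclideanSpace.single i (1 : ℝ) : Plane)} F).toLp 2 volume) := by
  rw [inner_schwartz_toLp, inner_schwartz_toLp, ← hφ i,
    TemperedDistribution.lineDerivOp_apply_apply, ← SchwartzMap.lineDerivOp_conjMap]
  simp [integral_neg]

theorem SchwartzMap.toLp_add' {E : Type*} [NormedAddCommGroup E] [NormedSpace ℝ E]
    [MeasurableSpace E] [BorelSpace E] [SecondCountableTopology E] (μ : Measure E)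
    [μ.HasTemperateGrowth] (f g : 𝓢(E, ℂ)) :
    (f + g).toLp 2 μ = f.toLp 2 μ + g.toLp 2 μ :=
  map_add (SchwartzMap.toLpCLM ℝ ℂ 2 μ) f g

theorem hasWeakGradient_schwartz (F : 𝓢(Plane, ℂ)) : HasWeakGradient (F.toLp 2 volume)
    fun i => (∂_{(EuclideanSpace.single i (1 : ℝ) : Plane)} F).toLp 2 volume := by
  intro i
  rw [Lp.toTemperedDistribution_toLp_eq, Lp.toTemperedDistribution_toLp_eq]
  exact TemperedDistribution.lineDerivOp_toTemperedDistributionCLM_eq F _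

namespace StraightMetricGraph

variable {J : Type*} [Finite J] (Γ : StraightMetricGraph J)

theorem mem_hamiltonianGraph (ε : ℝ) (ψ η : L2Plane) : (ψ, η) ∈ Γ.hamiltonianGraph ε ↔
    ∃ (g : Fin 2 → L2Plane) (w : L2Plane), HasWeakGradient ψ g ∧ Γ.IsDistMul ψ w ∧
    ∀ (φ : L2Plane) (h : Fin 2 → L2Plane) (v : L2Plane),
      HasWeakGradient φ h → Γ.IsDistMul φ v →
      (1 / 2 : ℂ) * ∑ i, inner ℂ (h i) (g i) + (1 / (2 * (ε : ℂ) ^ 2)) * inner ℂ v w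
        = inner ℂ φ η := Iff.rfl

theorem isDistMul_schwartz (F : 𝓢(Plane, ℂ))
    (h1 : MemLp (fun q => (Γ.distTo q : ℂ) * F q) 2 (volume : Measure Plane)) :
    Γ.IsDistMul (F.toLp 2 volume) h1.toLp := by
  rw [IsDistMul]
  filter_upwards [F.coeFn_toLp 2 volume, h1.coeFn_toLp] with q hq1 hq2
  rw [hq1, hq2]

theorem IsDistMul.inner_distTo_mul {φ v : L2Plane} (hv : Γ.IsDistMul φ v) (F : Plane → ℂ)
    (h1 : MemLp (fun q => (Γ.distTo q : ℂ) * F q) 2 (volume : Measure Plane))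
    (h2 : MemLp (fun q => (Γ.distTo q : ℂ) ^ 2 * F q) 2 (volume : Measure Plane)) :
    inner ℂ v h1.toLp = inner ℂ φ h2.toLp := by
  rw [L2.inner_def, L2.inner_def]
  refine integral_congr_ae ?_
  filter_upwards [hv, h1.coeFn_toLp, h2.coeFn_toLp] with q hq1 hq2 hq3
  rw [hq1, hq2, hq3]
  simp only [RCLike.inner_apply, map_mul, Complex.conj_ofReal]
  ring

open Laplacian in
theorem toLp_laplacian_eq_sum (F : 𝓢(Plane, ℂ)) :
    (Δ F).toLp 2 (volume : Measure Plane) = ∑ i : Fin 2,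
      (∂_{(EuclideanSpace.single i (1 : ℝ) : Plane)}
        (∂_{(EuclideanSpace.single i (1 : ℝ) : Plane)} F)).toLp 2 volume := by
  rw [SchwartzMap.laplacian_eq_sum (EuclideanSpace.basisFun (Fin 2) ℝ), Fin.sum_univ_two,
    Fin.sum_univ_two, SchwartzMap.toLp_add']
  simp only [EuclideanSpace.basisFun_apply]

-- Integrating by parts once against the weak gradient of the arbitrary form-domain element puts all
-- derivatives on $F$, and one factor $d_\Gamma$ is moved across as a real multiplier. No regularity
-- of $d_\Gamma$ is needed beyond $d_\Gamma F,\ d_\Gamma^2F\in L^2$.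
open Laplacian in
theorem mem_hamiltonianGraph_of_schwartz (ε : ℝ) (F : 𝓢(Plane, ℂ)) (G : L2Plane)
    (h1 : MemLp (fun q => (Γ.distTo q : ℂ) * F q) 2 (volume : Measure Plane))
    (hG : ∀ᵐ q, G q = (Γ.distTo q : ℂ) ^ 2 * F q) :
    (F.toLp 2 volume, (-(1 / 2) : ℂ) • (Δ F).toLp 2 volume +
      (1 / (2 * (ε : ℂ) ^ 2)) • G) ∈ Γ.hamiltonianGraph ε := by
  rw [mem_hamiltonianGraph]
  have h2 : MemLp (fun q => (Γ.distTo q : ℂ) ^ 2 * F q) 2 (volume : Measure Plane) :=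
    (memLp_congr_ae hG).1 (Lp.memLp G)
  have e0 : G = h2.toLp := Lp.ext (EventuallyEq.trans hG h2.coeFn_toLp.symm)
  refine ⟨_, h1.toLp, hasWeakGradient_schwartz F, Γ.isDistMul_schwartz F h1,
    fun φ h v hφ hv => ?_⟩
  rw [hv.inner_distTo_mul Γ F h1 h2, ← e0, toLp_laplacian_eq_sum, inner_add_right,
    inner_smul_right, inner_smul_right, inner_sum]
  simp only [hφ.inner_lineDerivOp, Finset.sum_neg_distrib]
  ring

/-! ### The distance to the graph near an edge -/

theorem distTo_nonneg (q : Plane) : 0 ≤ Γ.distTo q := Metric.infDist_nonneg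

theorem sub_foot (j : J) (q : Plane) :
    q - (Γ.start j + (Γ.coords j q).1 • Γ.dir j) = (Γ.coords j q).2 • perp (Γ.dir j) := by
  have h := Γ.point_coords j q
  rw [point] at h
  nth_rewrite 1 [← h]
  exact add_sub_cancel_left _ _

/-- The foot of the perpendicular belongs to the edge. -/
theorem distTo_le (j : J) (q : Plane) (h0 : 0 ≤ (Γ.coords j q).1)
    (h1 : ((Γ.coords j q).1 : EReal) ≤ Γ.len j) : Γ.distTo q ≤ |(Γ.coords j q).2| := by
  refine (Metric.infDist_le_dist_of_mem (s := Γ.support) ⟨j, _, h0, h1, rfl⟩).trans ?_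
  rw [dist_eq_norm, Γ.sub_foot, norm_smul, Γ.norm_perp_dir, mul_one, Real.norm_eq_abs]

theorem isClosed_edge (k : J) :
    IsClosed {q | ∃ x : ℝ, 0 ≤ x ∧ (x : EReal) ≤ Γ.len k ∧ q = Γ.start k + x • Γ.dir k} := by
  have h1 : IsClosed {x : ℝ | 0 ≤ x ∧ (x : EReal) ≤ Γ.len k} :=
    (isClosed_le continuous_const continuous_id).inter
      (isClosed_le continuous_coe_real_ereal continuous_const)
  have h2 : Isometry fun x : ℝ => Γ.start k + x • Γ.dir k := by
    refine Isometry.of_dist_eq fun x y => ?_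
    rw [dist_add_left, dist_eq_norm, ← sub_smul, norm_smul, Γ.norm_dir, mul_one, dist_eq_norm]
  convert! h2.isClosedEmbedding.isClosedMap _ h1 using 1
  ext q
  simp only [mem_ofPred_eq, mem_image]
  constructor
  · rintro ⟨x, h, h', rfl⟩
    exact ⟨x, ⟨h, h'⟩, rfl⟩
  · rintro ⟨x, ⟨h, h'⟩, rfl⟩
    exact ⟨x, h, h', rfl⟩

/-- By embeddedness the compact piece of the edge over `K` is disjoint from the union of the other
edges, which is closed because there are finitely many; the two sets are a positive distance apart.
Close to the piece no other edge competes, and points of the edge itself are never nearer than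
$|y_j|$. -/
theorem exists_distTo_eq (j : J) {K : Set ℝ} (hK : IsCompact K)
    (hKl : K ⊆ {x | 0 < x ∧ (x : EReal) < Γ.len j}) :
    ∃ δ : ℝ, 0 < δ ∧ ∀ q, (Γ.coords j q).1 ∈ K → |(Γ.coords j q).2| < δ →
      Γ.distTo q = |(Γ.coords j q).2| := by
  have hA : IsCompact ((fun x : ℝ => Γ.start j + x • Γ.dir j) '' K) :=
    hK.image (by fun_prop)
  have hB : IsClosed (⋃ k : {k // k ≠ j},
      {q | ∃ x : ℝ, 0 ≤ x ∧ (x : EReal) ≤ Γ.len k ∧ q = Γ.start k + x • Γ.dir k}) :=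
    isClosed_iUnion_of_finite fun k => Γ.isClosed_edge k
  have hd : Disjoint ((fun x : ℝ => Γ.start j + x • Γ.dir j) '' K) (⋃ k : {k // k ≠ j},
      {q | ∃ x : ℝ, 0 ≤ x ∧ (x : EReal) ≤ Γ.len k ∧ q = Γ.start k + x • Γ.dir k}) := by
    rw [Set.disjoint_left]
    rintro _ ⟨x, hx, rfl⟩ hq
    obtain ⟨k, y, hy0, hy1, hy⟩ := mem_iUnion.1 hq
    exact k.2 (Γ.embedded j k x y (hKl hx).1 (hKl hx).2 hy0 hy1 hy).symm
  obtain ⟨r, hr, hrd⟩ := Metric.exists_pos_forall_lt_edist hA hB hd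
  -- If $|y|<r/2$, points of other edges are farther than $r-|y|>|y|$.
  refine ⟨r / 2, by positivity, fun q hq hy => le_antisymm
    (Γ.distTo_le j q (hKl hq).1.le (hKl hq).2.le) ?_⟩
  have hne : Γ.support.Nonempty := ⟨_, j, _, (hKl hq).1.le, (hKl hq).2.le, rfl⟩
  refine (Metric.le_infDist hne).2 ?_
  rintro z ⟨k, x, hx0, hx1, rfl⟩
  by_cases hkj : k = j
  · subst hkj
    have h1 : (Γ.coords k q).2 =
        inner ℝ (perp (Γ.dir k)) (q - (Γ.start k + x • Γ.dir k)) := by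
      rw [← sub_sub, inner_sub_right, inner_smul_right,
        real_inner_comm (Γ.dir k) (perp (Γ.dir k)), Γ.inner_dir_perp, mul_zero, sub_zero]
      rfl
    rw [h1, dist_eq_norm]
    refine (abs_real_inner_le_norm _ _).trans ?_
    rw [Γ.norm_perp_dir, one_mul]
  · have h1 := hrd _ (mem_image_of_mem _ hq) (Γ.start k + x • Γ.dir k)
      (mem_iUnion.2 ⟨⟨k, hkj⟩, x, hx0, hx1, rfl⟩)
    rw [edist_nndist, ENNReal.coe_lt_coe, ← NNReal.coe_lt_coe, coe_nndist] at h1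
    have h2 : dist q (Γ.start j + (Γ.coords j q).1 • Γ.dir j) = |(Γ.coords j q).2| := by
      rw [dist_eq_norm, Γ.sub_foot, norm_smul, Γ.norm_perp_dir, mul_one, Real.norm_eq_abs]
    have h3 := dist_triangle_left (Γ.start j + (Γ.coords j q).1 • Γ.dir j)
      (Γ.start k + x • Γ.dir k) q
    linarith

end StraightMetricGraph

/-! ### Scaling of the transverse modes -/

theorem transverseMode_sq_scaling (n : ℕ) {ε : ℝ} (hε : 0 < ε) (y : ℝ) :
    transverseMode n ε y ^ 2 = (Real.sqrt ε)⁻¹ * transverseMode n 1 ((Real.sqrt ε)⁻¹ * y) ^ 2 := by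
  have h1 : ((Real.pi * ε) ^ (-(1 / 4) : ℝ)) ^ 2 =
      (Real.sqrt ε)⁻¹ * ((Real.pi * 1) ^ (-(1 / 4) : ℝ)) ^ 2 := by
    rw [mul_one, Real.mul_rpow Real.pi_pos.le hε.le, mul_pow, mul_comm]
    congr 1
    rw [← Real.rpow_natCast, ← Real.rpow_mul hε.le, Real.sqrt_eq_rpow, ← Real.rpow_neg hε.le]
    norm_num
  have h2 : Real.sqrt 2 * ((Real.sqrt ε)⁻¹ * y) / Real.sqrt 1 = Real.sqrt 2 * y / Real.sqrt ε := by
    rw [Real.sqrt_one]; ring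
  have h3 : ((Real.sqrt ε)⁻¹ * y) ^ 2 / (2 * 1) = y ^ 2 / (2 * ε) := by
    rw [mul_pow, inv_pow, Real.sq_sqrt hε.le]
    field_simp
  rw [transverseMode, transverseMode, h2, h3]
  simp only [mul_pow] at h1 ⊢
  rw [h1]
  ring

/-- Up to the factor $\varepsilon^{-1/4}$ the mode is a function of $y/\sqrt\varepsilon$, so each
power of $y$ is worth $\sqrt\varepsilon$ in $L^2$. -/
theorem integral_pow_mul_transverseMode_sq (n k : ℕ) {ε : ℝ} (hε : 0 < ε) :
    ∫ y, (y ^ k * transverseMode n ε y) ^ 2 = ε ^ k * ∫ y, (y ^ k * transverseMode n 1 y) ^ 2 := by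
  have hs := Real.sqrt_pos.2 hε
  have h1 : ∀ y, (y ^ k * transverseMode n ε y) ^ 2 = (ε ^ k * (Real.sqrt ε)⁻¹) *
      (fun z => (z ^ k * transverseMode n 1 z) ^ 2) ((Real.sqrt ε)⁻¹ * y) := fun y => by
    have h2 : ((Real.sqrt ε)⁻¹ ^ k) ^ 2 = (ε ^ k)⁻¹ := by
      rw [← pow_mul, mul_comm k 2, pow_mul, inv_pow, Real.sq_sqrt hε.le, inv_pow]
    simp only [mul_pow, h2]
    rw [transverseMode_sq_scaling n hε]
    field_simp
  simp_rw [h1]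
  rw [integral_const_mul,
    Measure.integral_comp_mul_left (fun z => (z ^ k * transverseMode n 1 z) ^ 2), inv_inv, abs_of_pos hs, smul_eq_mul]
  field_simp

/-! ### The Hamiltonian on transverse modes along an edge -/

/-- The Schwartz function `y ↦ yᵏ b(y)`. -/
noncomputable def SchwartzMap.powMul (k : ℕ) (b : 𝓢(ℝ, ℂ)) : 𝓢(ℝ, ℂ) :=
  SchwartzMap.smulLeftCLM ℂ (fun y : ℝ => y ^ k) b

theorem SchwartzMap.powMul_apply (k : ℕ) (b : 𝓢(ℝ, ℂ)) (y : ℝ) :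
    b.powMul k y = (y : ℂ) ^ k * b y := by
  rw [SchwartzMap.powMul, SchwartzMap.smulLeftCLM_apply_apply
    (show Function.HasTemperateGrowth fun y : ℝ => y ^ k from
      Function.HasTemperateGrowth.id'.pow k)]
  simp

namespace StraightMetricGraph

variable {J : Type*} [Finite J] (Γ : StraightMetricGraph J)

theorem norm_edgeTensor_toLp (j : J) (a b : 𝓢(ℝ, ℂ)) :
    ‖(Γ.edgeTensor j a b).toLp 2 (volume : Measure Plane)‖ =
      ‖a.toLp 2 (volume : Measure ℝ)‖ * ‖b.toLp 2 (volume : Measure ℝ)‖ := by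
  refine (pow_left_inj₀ (norm_nonneg _) (by positivity) two_ne_zero).1 ?_
  have h : ∀ c : 𝓢(ℝ, ℂ), ‖c.toLp 2 (volume : Measure ℝ)‖ ^ 2 = ∫ x, ‖c x‖ ^ 2 := fun c => by
    rw [L2_norm_sq_eq]
    refine integral_congr_ae ?_
    filter_upwards [c.coeFn_toLp 2 (volume : Measure ℝ)] with x hx
    rw [hx]
  rw [mul_pow, h, h, L2_norm_sq_eq]
  have h1 : ∫ q, ‖(Γ.edgeTensor j a b).toLp 2 (volume : Measure Plane) q‖ ^ 2 =
      ∫ q, (fun z : ℝ × ℝ => ‖a z.1‖ ^ 2 * ‖b z.2‖ ^ 2) (Γ.coords j q) := by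
    refine integral_congr_ae ?_
    filter_upwards [(Γ.edgeTensor j a b).coeFn_toLp 2 (volume : Measure Plane)] with q hq
    rw [hq, edgeTensor_apply, norm_mul, mul_pow]
  exact (h1.trans (Γ.integral_coords j (fun z : ℝ × ℝ => ‖a z.1‖ ^ 2 * ‖b z.2‖ ^ 2))).trans
    (integral_prod_mul (fun x => ‖a x‖ ^ 2) (fun y => ‖b y‖ ^ 2))

theorem edgeTensor_toLp_eq_lift (j : J) (n : ℕ) {ε : ℝ} (hε : 0 < ε) (a : 𝓢(ℝ, ℂ)) :
    (Γ.edgeTensor j a (modeSchwartz n hε)).toLp 2 (volume : Measure Plane) =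
      Γ.lift j n hε (a.toLp 2 volume) := by
  refine Lp.ext ?_
  filter_upwards [(Γ.edgeTensor j a (modeSchwartz n hε)).coeFn_toLp 2 (volume : Measure Plane),
    Γ.coeFn_lift j n hε (a.toLp 2 volume), Γ.ae_coords_fst j (a.coeFn_toLp 2 volume)]
    with q h1 h2 h3
  rw [h1, h2, h3, edgeTensor_apply, modeSchwartz_apply]

theorem continuous_distTo : Continuous Γ.distTo := Metric.continuous_infDist_pt _

/-- Where `a` does not vanish, $d_\Gamma\le|y_j|$, so the product is dominated by the Schwartz
function $a(x_j)\,y_j^k\,b(y_j)$. -/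
theorem memLp_distTo_pow_mul (j : J) (a b : 𝓢(ℝ, ℂ))
    (ha : ∀ x, a x ≠ 0 → 0 ≤ x ∧ (x : EReal) ≤ Γ.len j) (k : ℕ) :
    MemLp (fun q => (Γ.distTo q : ℂ) ^ k * Γ.edgeTensor j a b q) 2 (volume : Measure Plane) := by
  have h := (Γ.edgeTensor j a (b.powMul k)).memLp 2 (volume : Measure Plane)
  refine h.of_le ?_ (Eventually.of_forall fun q => ?_)
  · exact (((Complex.continuous_ofReal.comp Γ.continuous_distTo).pow k).mul
      (Γ.edgeTensor j a b).continuous).aestronglyMeasurable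
  · simp only [edgeTensor_apply, SchwartzMap.powMul_apply, norm_mul, norm_pow, Complex.norm_real,
      Real.norm_eq_abs, abs_of_nonneg (Γ.distTo_nonneg q)]
    by_cases hq : a (Γ.coords j q).1 = 0
    · simp [hq]
    · have h1 := pow_le_pow_left₀ (Γ.distTo_nonneg q)
        (Γ.distTo_le j q (ha _ hq).1 (ha _ hq).2) k
      calc _ ≤ |(Γ.coords j q).2| ^ k *
            (‖a (Γ.coords j q).1‖ * ‖b (Γ.coords j q).2‖) :=
            mul_le_mul_of_nonneg_right h1 (by positivity)
        _ = _ := by ring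

/-- The longitudinal kinetic energy, minus half the second derivative. -/
noncomputable def kinetic (a : 𝓢(ℝ, ℂ)) : 𝓢(ℝ, ℂ) :=
  (-(1 / 2) : ℂ) • SchwartzMap.derivCLM ℂ ℂ (SchwartzMap.derivCLM ℂ ℂ a)

open Laplacian in
theorem laplacian_edgeTensor_modeSchwartz (j : J) (n : ℕ) {ε : ℝ} (hε : 0 < ε) (a : 𝓢(ℝ, ℂ)) :
    (-(1 / 2) : ℂ) • Δ (Γ.edgeTensor j a (modeSchwartz n hε)) =
      Γ.edgeTensor j (kinetic a) (modeSchwartz n hε) +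
      (((modeEnergy n / ε : ℝ) : ℂ) • Γ.edgeTensor j a (modeSchwartz n hε) -
      (1 / (2 * (ε : ℂ) ^ 2)) • Γ.edgeTensor j a ((modeSchwartz n hε).powMul 2)) := by
  have hε' : (ε : ℂ) ≠ 0 := by exact_mod_cast hε.ne'
  have h1 : ∀ y, SchwartzMap.derivCLM ℂ ℂ (SchwartzMap.derivCLM ℂ ℂ (modeSchwartz n hε)) y =
      (((y ^ 2 / ε ^ 2 - 2 * (modeEnergy n / ε)) : ℝ) : ℂ) * modeSchwartz n hε y :=
    fun y => deriv_deriv_modeSchwartz n hε y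
  rw [Γ.laplacian_edgeTensor]
  ext q
  simp only [smul_apply, add_apply, sub_apply, edgeTensor_apply, h1, kinetic,
    SchwartzMap.powMul_apply, smul_eq_mul]
  push_cast
  field_simp
  ring

/-- The eigenvalue equation turns $-\tfrac12\partial_y^2$ into
$E_n/\varepsilon-y^2/(2\varepsilon^2)$. The first term is cancelled by the shift, and what survives
of the potential is the discrepancy between $d_\Gamma^2$ and $y_j^2$. -/
theorem exists_mem_shiftedHamiltonian (j : J) (n : ℕ) {ε : ℝ} (hε : 0 < ε) (a : 𝓢(ℝ, ℂ))
    (ha : ∀ x, a x ≠ 0 → 0 ≤ x ∧ (x : EReal) ≤ Γ.len j) :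
    ∃ e : L2Plane, (Γ.lift j n hε (a.toLp 2 volume),
        Γ.lift j n hε ((kinetic a).toLp 2 volume) + e) ∈ (Γ.shiftedHamiltonian n ε).graph ∧
      ∀ᵐ q, e q = (((Γ.distTo q ^ 2 - (Γ.coords j q).2 ^ 2) / (2 * ε ^ 2) : ℝ) : ℂ) *
        Γ.edgeTensor j a (modeSchwartz n hε) q := by
  set Φ := modeSchwartz n hε with hΦ
  have h1 := Γ.memLp_distTo_pow_mul j a Φ ha 1
  have h2 := Γ.memLp_distTo_pow_mul j a Φ ha 2
  simp only [pow_one] at h1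
  refine ⟨(1 / (2 * (ε : ℂ) ^ 2)) • (h2.toLp -
    (Γ.edgeTensor j a (Φ.powMul 2)).toLp 2 (volume : Measure Plane)), ?_, ?_⟩
  · rw [Γ.mem_graph_shiftedHamiltonian, ← edgeTensor_toLp_eq_lift, ← edgeTensor_toLp_eq_lift]
    have h3 := Γ.mem_hamiltonianGraph_of_schwartz ε (Γ.edgeTensor j a Φ) h2.toLp h1 h2.coeFn_toLp
    have h4 := congrArg (SchwartzMap.toLpCLM ℂ ℂ 2 (volume : Measure Plane))
      (Γ.laplacian_edgeTensor_modeSchwartz j n hε a)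
    rw [map_smul, map_add, map_sub, map_smul, map_smul] at h4
    simp only [SchwartzMap.toLpCLM_apply] at h4
    rw [h4] at h3
    convert! h3 using 2
    rw [smul_sub]
    abel
  · filter_upwards [Lp.coeFn_smul (1 / (2 * (ε : ℂ) ^ 2)) (h2.toLp -
      (Γ.edgeTensor j a (Φ.powMul 2)).toLp 2 (volume : Measure Plane)),
      Lp.coeFn_sub h2.toLp ((Γ.edgeTensor j a (Φ.powMul 2)).toLp 2 (volume : Measure Plane)),
      h2.coeFn_toLp, (Γ.edgeTensor j a (Φ.powMul 2)).coeFn_toLp 2 (volume : Measure Plane)]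
      with q e1 e2 e3 e4
    rw [e1, Pi.smul_apply, e2, Pi.sub_apply, e3, e4]
    simp only [edgeTensor_apply, SchwartzMap.powMul_apply, smul_eq_mul]
    push_cast
    ring

theorem norm_powMul_modeSchwartz (n k : ℕ) {ε : ℝ} (hε : 0 < ε) :
    ‖((modeSchwartz n hε).powMul k).toLp 2 (volume : Measure ℝ)‖ ^ 2 =
      ε ^ k * ∫ y, (y ^ k * transverseMode n 1 y) ^ 2 := by
  rw [L2_norm_sq_eq, ← integral_pow_mul_transverseMode_sq n k hε]
  refine integral_congr_ae ?_
  filter_upwards [((modeSchwartz n hε).powMul k).coeFn_toLp 2 (volume : Measure ℝ)] with y hy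
  rw [hy, SchwartzMap.powMul_apply, modeSchwartz_apply, norm_mul, norm_pow, Complex.norm_real,
    Complex.norm_real, Real.norm_eq_abs, Real.norm_eq_abs, ← abs_pow, ← abs_mul, sq_abs]

/-- On test functions, the shifted Hamiltonian acts as the longitudinal kinetic energy up to an
error that vanishes as `ε → 0`. -/
theorem exists_mem_shiftedHamiltonian_norm_le (j : J) (n : ℕ) {K : Set ℝ} (hK : IsCompact K)
    (hKl : K ⊆ {x | 0 < x ∧ (x : EReal) < Γ.len j}) :
    ∃ C : ℝ, 0 ≤ C ∧ ∀ (ε : ℝ) (hε : 0 < ε) (a : 𝓢(ℝ, ℂ)), (∀ x, a x ≠ 0 → x ∈ K) →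
      ∃ e : L2Plane, (Γ.lift j n hε (a.toLp 2 volume),
        Γ.lift j n hε ((kinetic a).toLp 2 volume) + e) ∈ (Γ.shiftedHamiltonian n ε).graph ∧
        ‖e‖ ≤ C * ε * ‖a.toLp 2 (volume : Measure ℝ)‖ := by
  obtain ⟨δ, hδ, hd⟩ := Γ.exists_distTo_eq j hK hKl
  -- The error vanishes for $|y|<\delta$ and otherwise is at most $y^2/(2\varepsilon^2)\le
  -- y^6/(2\varepsilon^2\delta^4)$ times the mode. Since
  -- $\|y^6\Phi_n^\varepsilon\|=\varepsilon^3\sqrt M$, four extra powers of $|y|$ leave exactly one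
  -- factor $\varepsilon$.
  set M : ℝ := ∫ y, (y ^ 6 * transverseMode n 1 y) ^ 2 with hM
  have hM0 : 0 ≤ M := integral_nonneg fun y => by positivity
  refine ⟨1 / (2 * δ ^ 4) * Real.sqrt M, by positivity, fun ε hε a ha => ?_⟩
  obtain ⟨e, he, heq⟩ := Γ.exists_mem_shiftedHamiltonian j n hε a
    fun x hx => ⟨(hKl (ha x hx)).1.le, (hKl (ha x hx)).2.le⟩
  refine ⟨e, he, ?_⟩
  have h1 : ‖e‖ ≤ 1 / (2 * ε ^ 2 * δ ^ 4) *
      ‖(Γ.edgeTensor j a ((modeSchwartz n hε).powMul 6)).toLp 2 (volume : Measure Plane)‖ := by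
    refine Lp.norm_le_mul_norm_of_ae_le_mul ?_
    filter_upwards [heq, (Γ.edgeTensor j a ((modeSchwartz n hε).powMul 6)).coeFn_toLp 2
      (volume : Measure Plane)] with q h1 h2
    rw [h1, h2]
    simp only [edgeTensor_apply, SchwartzMap.powMul_apply, norm_mul, norm_pow, Complex.norm_real,
      Real.norm_eq_abs]
    by_cases hq : a (Γ.coords j q).1 = 0
    · simp [hq]
    set y := (Γ.coords j q).2 with hy
    have hx := ha _ hq
    have h3 : |(Γ.distTo q ^ 2 - y ^ 2) / (2 * ε ^ 2)| ≤ 1 / (2 * ε ^ 2 * δ ^ 4) * |y| ^ 6 := by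
      rw [abs_div, abs_of_pos (show 0 < 2 * ε ^ 2 by positivity), div_le_iff₀ (by positivity)]
      have h4 : 1 / (2 * ε ^ 2 * δ ^ 4) * |y| ^ 6 * (2 * ε ^ 2) = |y| ^ 6 / δ ^ 4 := by
        field_simp
      rw [h4, le_div_iff₀ (by positivity)]
      by_cases hyδ : |y| < δ
      · rw [hd q hx hyδ, sq_abs, sub_self, abs_zero, zero_mul]
        positivity
      · have h5 := Γ.distTo_le j q (hKl hx).1.le (hKl hx).2.le
        have h6 := pow_le_pow_left₀ (Γ.distTo_nonneg q) h5 2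
        have h7 := pow_le_pow_left₀ hδ.le (not_lt.1 hyδ) 4
        rw [← sq_abs y]
        have h8 : |Γ.distTo q ^ 2 - |y| ^ 2| ≤ |y| ^ 2 := by
          rw [abs_le]
          constructor <;> nlinarith [sq_nonneg (Γ.distTo q)]
        calc _ ≤ |y| ^ 2 * |y| ^ 4 := mul_le_mul h8 h7 (by positivity) (by positivity)
          _ = |y| ^ 6 := by ring
    calc _ ≤ 1 / (2 * ε ^ 2 * δ ^ 4) * |y| ^ 6 *
          (‖a (Γ.coords j q).1‖ * ‖modeSchwartz n hε y‖) :=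
          mul_le_mul_of_nonneg_right h3 (by positivity)
      _ = _ := by ring
  refine h1.trans (le_of_eq ?_)
  have h2 : ‖((modeSchwartz n hε).powMul 6).toLp 2 (volume : Measure ℝ)‖ =
      ε ^ 3 * Real.sqrt M := by
    refine (pow_left_inj₀ (norm_nonneg _) (by positivity) two_ne_zero).1 ?_
    rw [norm_powMul_modeSchwartz, mul_pow, Real.sq_sqrt hM0]
    ring
  rw [norm_edgeTensor_toLp, h2]
  field_simp

theorem initialState_eq_lift {j : J} {f : ℝ → ℂ} (hf : Γ.IsTestFunctionOn j f) (n : ℕ) {ε : ℝ}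
    (hε : 0 < ε) : Γ.initialState hf n hε =
      Γ.lift j n hε ((hf.hasCompactSupport.toSchwartzMap hf.contDiff).toLp 2 volume) := by
  rw [← edgeTensor_toLp_eq_lift]
  refine Lp.ext ?_
  refine (Γ.memLp_initial hf n hε).coeFn_toLp.trans ?_
  filter_upwards [(Γ.edgeTensor j (hf.hasCompactSupport.toSchwartzMap hf.contDiff)
    (modeSchwartz n hε)).coeFn_toLp 2 (volume : Measure Plane)] with q hq
  rw [hq, edgeTensor_apply, modeSchwartz_apply]
  rfl

/-- Scaling makes the bound independent of $\varepsilon$; the value of the norm of the mode is never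
needed. -/
theorem norm_lift_le_uniform (j : J) (n : ℕ) {ε : ℝ} (hε : 0 < ε) :
    ‖Γ.lift j n hε‖ ≤ Real.sqrt (∫ y, transverseMode n 1 y ^ 2) := by
  refine (Γ.norm_lift_le j n hε).trans (le_of_eq ?_)
  have := integral_pow_mul_transverseMode_sq n 0 hε
  simp only [pow_zero, one_mul] at this
  rw [this]

end StraightMetricGraph

/-! ### Weak-* compactness -/

/-- Sequential Banach–Alaoglu in the dual of a separable space, transported through the Riesz
isometry. -/
theorem exists_weakly_convergent_subseq {H : Type*} [NormedAddCommGroup H] [InnerProductSpace ℂ H]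
    [CompleteSpace H] [TopologicalSpace.SeparableSpace H] (x : ℕ → H) (C : ℝ)
    (hx : ∀ k, ‖x k‖ ≤ C) : ∃ (y : H) (κ : ℕ → ℕ), StrictMono κ ∧
      ∀ u, Tendsto (fun k => inner ℂ u (x (κ k))) atTop (𝓝 (inner ℂ u y)) := by
  set L : ℕ → WeakDual ℂ H := fun k =>
    StrongDual.toWeakDual (InnerProductSpace.toDual ℂ H (x k)) with hL
  obtain ⟨ℓ, -, κ, hκ, hlim⟩ := WeakDual.isSeqCompact_closedBall ℂ H 0 C
    (x := L) fun k => by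
      simpa [hL] using hx k
  refine ⟨(InnerProductSpace.toDual ℂ H).symm (WeakDual.toStrongDual ℓ), κ, hκ, fun u => ?_⟩
  have h1 : Tendsto (fun k => L (κ k) u) atTop (𝓝 (ℓ u)) :=
    ((WeakDual.eval_continuous u).tendsto ℓ).comp hlim
  have h2 := (Complex.continuous_conj.tendsto _).comp h1
  have h3 : conj (ℓ u) =
      inner ℂ u ((InnerProductSpace.toDual ℂ H).symm (WeakDual.toStrongDual ℓ)) := by
    rw [← inner_conj_symm, InnerProductSpace.toDual_symm_apply]
    rfl
  rw [← h3]
  refine h2.congr fun k => ?_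
  have : L (κ k) u = inner ℂ (x (κ k)) u := rfl
  rw [Function.comp, this, inner_conj_symm]

section

variable {α : Type*} [MeasurableSpace α] {μ : Measure α}
  {H : Type*} [NormedAddCommGroup H] [InnerProductSpace ℂ H]

theorem integrable_inner_of_bounded {g F : α → H} {C : ℝ} (hg : Integrable g μ)
    (hF : AEStronglyMeasurable F μ) (hC : ∀ᵐ t ∂μ, ‖F t‖ ≤ C) :
    Integrable (fun t => inner ℂ (g t) (F t)) μ := by
  refine (hg.norm.mul_const C).mono' (hg.1.inner hF) ?_
  filter_upwards [hC] with t ht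
  exact (norm_inner_le_norm _ _).trans (mul_le_mul_of_nonneg_left ht (norm_nonneg _))

theorem norm_integral_inner_le {g F : α → H} {C : ℝ} (hg : Integrable g μ)
    (hC : ∀ᵐ t ∂μ, ‖F t‖ ≤ C) :
    ‖∫ t, inner ℂ (g t) (F t) ∂μ‖ ≤ C * ∫ t, ‖g t‖ ∂μ := by
  rw [← integral_const_mul]
  refine norm_integral_le_of_norm_le (hg.norm.const_mul C) ?_
  filter_upwards [hC] with t ht
  rw [mul_comm]
  exact (norm_inner_le_norm _ _).trans (mul_le_mul_of_nonneg_left ht (norm_nonneg _))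

/-- The weak `L²` limit of functions bounded by `C` is bounded by `C`. -/
theorem ae_norm_le_of_weak_limit [IsFiniteMeasure μ] {f : ℕ → Lp H 2 μ} {G : Lp H 2 μ} {C : ℝ}
    (hC : ∀ k, ∀ᵐ t ∂μ, ‖f k t‖ ≤ C)
    (hlim : ∀ u : Lp H 2 μ, Tendsto (fun k => inner ℂ u (f k)) atTop (𝓝 (inner ℂ u G))) :
    ∀ᵐ t ∂μ, ‖G t‖ ≤ C := by
  have hG1 : Integrable (fun t => ‖G t‖) μ := ((Lp.memLp G).integrable (by norm_num)).norm
  have hG2 : Integrable (fun t => ‖G t‖ ^ 2) μ := (Lp.memLp G).integrable_norm_pow two_ne_zero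
  -- Testing against $1_sG$ gives $\int_s\|G\|^2\le C\int_s\|G\|$ for every measurable $s$, hence
  -- the inequality pointwise.
  have key : (fun t => ‖G t‖ ^ 2) ≤ᵐ[μ] fun t => C * ‖G t‖ := by
    refine ae_le_of_forall_setIntegral_le hG2 (hG1.const_mul C) fun s hs _ => ?_
    have hm : MemLp (s.indicator G) 2 μ := (Lp.memLp G).indicator hs
    have hinner : ∀ v : Lp H 2 μ, inner ℂ hm.toLp v = ∫ t in s, inner ℂ (G t) (v t) ∂μ :=
      fun v => by
        rw [L2.inner_def, ← integral_indicator hs]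
        refine integral_congr_ae ?_
        filter_upwards [hm.coeFn_toLp] with t ht
        rw [ht]
        by_cases hts : t ∈ s <;> simp [hts]
    have h1 := (hlim hm.toLp).norm
    have h2 : ∀ k, ‖inner ℂ hm.toLp (f k)‖ ≤ ∫ t in s, C * ‖G t‖ ∂μ := fun k => by
      rw [hinner, integral_const_mul]
      exact norm_integral_inner_le ((Lp.memLp G).integrable (by norm_num)).integrableOn
        (ae_restrict_of_ae (hC k))
    have h3 : ‖inner ℂ hm.toLp G‖ = ∫ t in s, ‖G t‖ ^ 2 ∂μ := by
      rw [hinner]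
      have : ∀ t, inner ℂ (G t) (G t) = ((‖G t‖ ^ 2 : ℝ) : ℂ) := fun t => by
        rw [inner_self_eq_norm_sq_to_K]
        push_cast
        rfl
      simp_rw [this]
      rw [integral_complex_ofReal, Complex.norm_real, Real.norm_eq_abs, abs_of_nonneg]
      exact integral_nonneg fun t => by positivity
    rw [← h3]
    exact le_of_tendsto' h1 h2
  filter_upwards [key, ae_all_iff.2 hC] with t ht htC
  have hC0 : 0 ≤ C := (norm_nonneg _).trans (htC 0)
  by_contra hlt
  push Not at hlt
  nlinarith [norm_nonneg (G t)]

/-- Weak `L²` convergence of uniformly bounded functions tests against all integrable functions. -/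
theorem tendsto_integral_inner_of_weak_limit [IsFiniteMeasure μ] {f : ℕ → Lp H 2 μ}
    {G : Lp H 2 μ} {C : ℝ} (hC0 : 0 ≤ C) (hC : ∀ k, ∀ᵐ t ∂μ, ‖f k t‖ ≤ C)
    (hlim : ∀ u : Lp H 2 μ, Tendsto (fun k => inner ℂ u (f k)) atTop (𝓝 (inner ℂ u G)))
    {g : α → H} (hg : Integrable g μ) :
    Tendsto (fun k => ∫ t, inner ℂ (g t) (f k t) ∂μ) atTop (𝓝 (∫ t, inner ℂ (g t) (G t) ∂μ)) := by
  have hCG := ae_norm_le_of_weak_limit hC hlim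
  rw [Metric.tendsto_atTop]
  intro η hη
  set ρ : ℝ := η / (3 * (C + 1)) with hρ
  have hρ0 : 0 < ρ := by positivity
  -- Simple functions approximate `g` in $L^1$ and lie in $L^2$ because the measure is finite; the
  -- uniform bound `C` controls the replacement.
  obtain ⟨g', hg', hg'1, hg'2⟩ : ∃ g' : α → H, eLpNorm (g - g') 1 μ < ENNReal.ofReal ρ ∧
      Integrable g' μ ∧ MemLp g' 2 μ := by
    obtain ⟨g', hg', hg'm⟩ := (memLp_one_iff_integrable.2 hg).exists_simpleFunc_eLpNorm_sub_lt
      (by simp) (ε := ENNReal.ofReal ρ) (by simpa using hρ0)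
    exact ⟨g', hg', memLp_one_iff_integrable.1 hg'm, SimpleFunc.memLp_of_isFiniteMeasure g' 2 μ⟩
  have hsub : Integrable (g - g') μ := hg.sub hg'1
  have hsmall : ∫ t, ‖(g - g') t‖ ∂μ < ρ := by
    rw [integral_norm_eq_lintegral_enorm hsub.1, ← eLpNorm_one_eq_lintegral_enorm]
    exact (ENNReal.toReal_lt_of_lt_ofReal hg')
  have hsplit : ∀ v : Lp H 2 μ, (∀ᵐ t ∂μ, ‖v t‖ ≤ C) →
      ‖∫ t, inner ℂ (g t) (v t) ∂μ - inner ℂ hg'2.toLp v‖ ≤ η / 3 := fun v hv => by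
    have e1 : inner ℂ hg'2.toLp v = ∫ t, inner ℂ (g' t) (v t) ∂μ := by
      rw [L2.inner_def]
      refine integral_congr_ae ?_
      filter_upwards [hg'2.coeFn_toLp] with t ht
      rw [ht]
    rw [e1, ← integral_sub (integrable_inner_of_bounded hg (Lp.memLp v).1 hv)
      (integrable_inner_of_bounded hg'1 (Lp.memLp v).1 hv)]
    simp_rw [← inner_sub_left]
    refine (norm_integral_inner_le hsub hv).trans ?_
    have h1 : C * ∫ t, ‖(g - g') t‖ ∂μ ≤ (C + 1) * ρ :=
      mul_le_mul (by linarith) hsmall.le (integral_nonneg fun t => norm_nonneg _) (by linarith)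
    refine h1.trans (le_of_eq ?_)
    rw [hρ]
    field_simp
  obtain ⟨N, hN⟩ := Metric.tendsto_atTop.1 (hlim hg'2.toLp) (η / 3) (by positivity)
  refine ⟨N, fun k hk => ?_⟩
  have h1 := hsplit (f k) (hC k)
  have h2 := hsplit G hCG
  have h3 := hN k hk
  rw [dist_eq_norm] at h3 ⊢
  have e : ∫ t, inner ℂ (g t) (f k t) ∂μ - ∫ t, inner ℂ (g t) (G t) ∂μ =
      (∫ t, inner ℂ (g t) (f k t) ∂μ - inner ℂ hg'2.toLp (f k)) +
      (inner ℂ hg'2.toLp (f k) - inner ℂ hg'2.toLp G) -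
      (∫ t, inner ℂ (g t) (G t) ∂μ - inner ℂ hg'2.toLp G) := by ring
  rw [e]
  refine (norm_sub_le _ _).trans_lt ?_
  have h4 := norm_add_le (∫ t, inner ℂ (g t) (f k t) ∂μ - inner ℂ hg'2.toLp (f k))
    (inner ℂ hg'2.toLp (f k) - inner ℂ hg'2.toLp G)
  linarith

end

/-- Sequential Banach-Alaoglu in `L^∞((0, T), L²(ℝ))`, for finitely many sequences at once. -/
theorem exists_weakStarTendsto {J : Type*} [Finite J] (T : ℝ) (F : J → ℕ → ℝ → L2Line)
    (hFc : ∀ j k, Continuous (F j k)) (C : ℝ) (hC0 : 0 ≤ C) (hC : ∀ j k t, ‖F j k t‖ ≤ C) :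
    ∃ κ : ℕ → ℕ, StrictMono κ ∧
      ∀ j, ∃ s : ℝ → L2Line, WeakStarTendsto T (fun k => F j (κ k)) s := by
  have := Fintype.ofFinite J
  set μ : Measure ℝ := volume.restrict (Ioo 0 T) with hμ
  have hm : ∀ j k p, MemLp (F j k) p μ := fun j k p =>
    MemLp.of_bound (hFc j k).aestronglyMeasurable C (Eventually.of_forall (hC j k))
  -- All edges are put in one Hilbert space, so that a single subsequence serves them
  -- simultaneously.
  set x : ℕ → PiLp 2 fun _ : J => Lp L2Line 2 μ := fun k =>
    WithLp.toLp 2 fun j => (hm j k 2).toLp with hx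
  have hae : ∀ j k, ∀ᵐ t ∂μ, ‖(hm j k 2).toLp _ t‖ ≤ C := fun j k => by
    filter_upwards [(hm j k 2).coeFn_toLp] with t ht
    rw [ht]
    exact hC j k t
  obtain ⟨B, hB⟩ : ∃ B, ∀ k, ‖x k‖ ≤ B := by
    refine ⟨Real.sqrt (∑ _j : J, ((measureUnivNNReal μ : ℝ) ^ (2 : ℝ≥0∞).toReal⁻¹ * C) ^ 2), fun k => ?_⟩
    rw [PiLp.norm_eq_of_L2]
    refine Real.sqrt_le_sqrt (Finset.sum_le_sum fun j _ => ?_)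
    refine pow_le_pow_left₀ (norm_nonneg _) ?_ 2
    exact Lp.norm_le_of_ae_bound hC0 (hae j k)
  have : Fact ((2 : ℝ≥0∞) ≠ ⊤) := ⟨by simp⟩
  have : SecondCountableTopology L2Line := Lp.SecondCountableTopology
  have : SecondCountableTopology (Lp L2Line 2 μ) := Lp.SecondCountableTopology
  obtain ⟨y, κ, hκ, hlim⟩ := exists_weakly_convergent_subseq x B hB
  have hlim' : ∀ (j : J) (u : Lp L2Line 2 μ),
      Tendsto (fun k => inner ℂ u ((hm j (κ k) 2).toLp)) atTop (𝓝 (inner ℂ u (y j))) := by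
    classical
    intro j u
    have h1 := hlim (WithLp.toLp 2 (Pi.single j u))
    have h2 : ∀ z : PiLp 2 fun _ : J => Lp L2Line 2 μ,
        inner ℂ (WithLp.toLp 2 (Pi.single j u) : PiLp 2 fun _ : J => Lp L2Line 2 μ) z =
          inner ℂ u (z j) := fun z => by
      rw [PiLp.inner_apply, Finset.sum_eq_single j]
      · simp
      · intro i _ hij
        simp [hij]
      · simp
    simp_rw [h2] at h1
    exact h1
  refine ⟨κ, hκ, fun j => ⟨y j, fun k => hm j (κ k) ∞, ?_, fun g hg => ?_⟩⟩
  · exact memLp_top_of_bound (Lp.memLp (y j)).1 C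
      (ae_norm_le_of_weak_limit (fun k => hae j (κ k)) (hlim' j))
  · refine (tendsto_integral_inner_of_weak_limit hC0 (fun k => hae j (κ k)) (hlim' j) hg).congr
      fun k => integral_congr_ae ?_
    filter_upwards [(hm j (κ k) 2).coeFn_toLp] with t ht
    rw [ht]

/-! ### Time slices of test functions -/

section Slices

variable {χ : ℝ × ℝ → ℂ}

theorem HasCompactSupport.slice (hc : HasCompactSupport χ) (t : ℝ) :
    HasCompactSupport fun x => χ (t, x) :=
  hc.comp_isClosedEmbedding (g := fun x : ℝ => (t, x)) 
    (Isometry.of_dist_eq fun x y => by simp [Prod.dist_eq]).isClosedEmbedding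

/-- The time slice `x ↦ χ(t, x)` of a test function. -/
noncomputable def timeSlice (hs : ContDiff ℝ ∞ χ) (hc : HasCompactSupport χ) (t : ℝ) : 𝓢(ℝ, ℂ) :=
  (hc.slice t).toSchwartzMap (by fun_prop)

theorem timeSlice_apply (hs : ContDiff ℝ ∞ χ) (hc : HasCompactSupport χ) (t x : ℝ) :
    timeSlice hs hc t x = χ (t, x) := rfl

theorem contDiff_fderiv_apply_const (hs : ContDiff ℝ ∞ χ) (v : ℝ × ℝ) :
    ContDiff ℝ ∞ fun z => fderiv ℝ χ z v :=
  (hs.fderiv_right (m := ∞) (by simp)).clm_apply contDiff_const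

theorem hasDerivAt_left (hs : ContDiff ℝ ∞ χ) (t x : ℝ) :
    HasDerivAt (fun τ => χ (τ, x)) (fderiv ℝ χ (t, x) (1, 0)) t := by
  have h1 : HasFDerivAt χ (fderiv ℝ χ (t, x)) (t, x) :=
    (hs.differentiable (by simp)).differentiableAt.hasFDerivAt
  exact h1.comp_hasDerivAt t ((hasDerivAt_id t).prodMk (hasDerivAt_const t x))

theorem hasDerivAt_right (hs : ContDiff ℝ ∞ χ) (t x : ℝ) :
    HasDerivAt (fun ξ => χ (t, ξ)) (fderiv ℝ χ (t, x) (0, 1)) x := by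
  have h1 : HasFDerivAt χ (fderiv ℝ χ (t, x)) (t, x) :=
    (hs.differentiable (by simp)).differentiableAt.hasFDerivAt
  exact h1.comp_hasDerivAt x ((hasDerivAt_const x t).prodMk (hasDerivAt_id x))

theorem derivCLM_timeSlice (hs : ContDiff ℝ ∞ χ) (hc : HasCompactSupport χ) (t : ℝ) :
    SchwartzMap.derivCLM ℂ ℂ (timeSlice hs hc t) =
      timeSlice (contDiff_fderiv_apply_const hs (0, 1)) (hc.fderiv_apply ℝ (0, 1)) t := by
  ext x
  exact (hasDerivAt_right hs t x).deriv

/-- Time slices are differentiable in `L²`. -/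
theorem hasDerivAt_timeSlice (hs : ContDiff ℝ ∞ χ) (hc : HasCompactSupport χ) (t : ℝ) :
    HasDerivAt (fun τ => (timeSlice hs hc τ).toLp 2 (volume : Measure ℝ))
      ((timeSlice (contDiff_fderiv_apply_const hs (1, 0)) (hc.fderiv_apply ℝ (1, 0)) t).toLp 2
        volume) t := by
  -- All slices vanish outside this one compact set, so an error bound uniform in $x$ becomes an
  -- $L^2$ bound with factor $\|1_K\|$.
  set K : Set ℝ := Prod.snd '' tsupport χ with hK
  have hKc : IsCompact K := hc.isCompact.image continuous_snd
  have hKm : volume K ≠ ⊤ := hKc.measure_lt_top.ne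
  set ind : L2Line := indicatorConstLp 2 hKc.measurableSet hKm (1 : ℂ) with h_ind
  have hχ0 : ∀ τ x, x ∉ K → χ (τ, x) = 0 := fun τ x hx =>
    image_eq_zero_of_notMem_tsupport fun h => hx ⟨_, h, rfl⟩
  have hχ0' : ∀ τ x, x ∉ K → fderiv ℝ χ (τ, x) (1, 0) = 0 := fun τ x hx =>
    image_eq_zero_of_notMem_tsupport (f := fun z => fderiv ℝ χ z (1, 0))
      fun h => hx ⟨_, tsupport_fderiv_apply_subset ℝ _ h, rfl⟩
  have huc : UniformContinuous fun z => fderiv ℝ χ z (1, 0) :=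
    (hc.fderiv_apply ℝ (1, 0)).uniformContinuous_of_continuous
      (contDiff_fderiv_apply_const hs (1, 0)).continuous
  rw [hasDerivAt_iff_isLittleO_nhds_zero, Asymptotics.isLittleO_iff]
  intro c hc0
  obtain ⟨δ, hδ, hδu⟩ := Metric.uniformContinuous_iff.1 huc (c / (‖ind‖ + 1)) (by positivity)
  filter_upwards [Metric.ball_mem_nhds (0 : ℝ) hδ] with h hh
  rw [mem_ball_zero_iff] at hh
  have hpt : ∀ x, ‖χ (t + h, x) - χ (t, x) - h • fderiv ℝ χ (t, x) (1, 0)‖ ≤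
      c / (‖ind‖ + 1) * ‖h‖ := fun x => by
    -- Mean value inequality for the slice minus its linear part, whose derivative is small by
    -- uniform continuity of $\partial_t\chi$.
    have h1 := Convex.norm_image_sub_le_of_norm_hasDerivWithin_le
      (f := fun s => χ (s, x) - (s - t) • fderiv ℝ χ (t, x) (1, 0))
      (f' := fun s => fderiv ℝ χ (s, x) (1, 0) - fderiv ℝ χ (t, x) (1, 0))
      (s := Metric.closedBall t ‖h‖) (x := t) (y := t + h) (C := c / (‖ind‖ + 1))
      (fun s _ => by
        have h2 := ((hasDerivAt_id s).sub_const t).smul_const (fderiv ℝ χ (t, x) (1, 0))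
        rw [one_smul] at h2
        exact ((hasDerivAt_left hs s x).sub h2).hasDerivWithinAt)
      (fun s hs' => by
        have h3 : dist (s, x) (t, x) < δ := by
          rw [Prod.dist_eq, dist_self, max_eq_left dist_nonneg]
          exact (Metric.mem_closedBall.1 hs').trans_lt hh
        rw [← dist_eq_norm]
        exact (hδu h3).le)
      (convex_closedBall t ‖h‖) (Metric.mem_closedBall_self (norm_nonneg h))
      (by simp)
    simpa [sub_right_comm] using h1
  have hnorm : ‖(timeSlice hs hc (t + h)).toLp 2 (volume : Measure ℝ) -
      (timeSlice hs hc t).toLp 2 volume - h • (timeSlice (contDiff_fderiv_apply_const hs (1, 0))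
        (hc.fderiv_apply ℝ (1, 0)) t).toLp 2 volume‖ ≤ c / (‖ind‖ + 1) * ‖h‖ * ‖ind‖ := by
    have e : (timeSlice hs hc (t + h)).toLp 2 (volume : Measure ℝ) -
        (timeSlice hs hc t).toLp 2 volume - h • (timeSlice (contDiff_fderiv_apply_const hs (1, 0))
        (hc.fderiv_apply ℝ (1, 0)) t).toLp 2 volume =
        (timeSlice hs hc (t + h) - timeSlice hs hc t -
          h • timeSlice (contDiff_fderiv_apply_const hs (1, 0))
            (hc.fderiv_apply ℝ (1, 0)) t).toLp 2 volume := by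
      have := map_sub (SchwartzMap.toLpCLM ℝ ℂ 2 (volume : Measure ℝ))
        (timeSlice hs hc (t + h) - timeSlice hs hc t)
        (h • timeSlice (contDiff_fderiv_apply_const hs (1, 0)) (hc.fderiv_apply ℝ (1, 0)) t)
      rw [map_sub, map_smul] at this
      exact this.symm
    rw [e]
    refine Lp.norm_le_mul_norm_of_ae_le_mul ?_
    filter_upwards [(timeSlice hs hc (t + h) - timeSlice hs hc t -
          h • timeSlice (contDiff_fderiv_apply_const hs (1, 0))
            (hc.fderiv_apply ℝ (1, 0)) t).coeFn_toLp 2 (volume : Measure ℝ),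
      indicatorConstLp_coeFn (p := 2) (hs := hKc.measurableSet) (hμs := hKm) (c := (1 : ℂ))]
      with x hx1 hx2
    rw [hx1, h_ind, hx2]
    simp only [sub_apply, smul_apply, timeSlice_apply]
    by_cases hx : x ∈ K
    · rw [indicator_of_mem hx, norm_one, mul_one]
      exact hpt x
    · rw [indicator_of_notMem hx, hχ0 _ _ hx, hχ0 _ _ hx, hχ0' _ _ hx]
      simp
  refine hnorm.trans ?_
  have h5 : c / (‖ind‖ + 1) * ‖ind‖ ≤ c := by
    rw [div_mul_eq_mul_div, div_le_iff₀ (by positivity)]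
    nlinarith [norm_nonneg ind]
  nlinarith [norm_nonneg h]

theorem continuous_timeSlice (hs : ContDiff ℝ ∞ χ) (hc : HasCompactSupport χ) :
    Continuous fun t => (timeSlice hs hc t).toLp 2 (volume : Measure ℝ) :=
  continuous_iff_continuousAt.2 fun t => (hasDerivAt_timeSlice hs hc t).continuousAt

theorem kinetic_timeSlice (hs : ContDiff ℝ ∞ χ) (hc : HasCompactSupport χ) (t : ℝ) :
    StraightMetricGraph.kinetic (timeSlice hs hc t) = (-(1 / 2) : ℂ) •
      timeSlice (contDiff_fderiv_apply_const (contDiff_fderiv_apply_const hs (0, 1)) (0, 1))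
        ((hc.fderiv_apply ℝ (0, 1)).fderiv_apply ℝ (0, 1)) t := by
  rw [StraightMetricGraph.kinetic, derivCLM_timeSlice, derivCLM_timeSlice]

theorem continuous_kinetic_timeSlice (hs : ContDiff ℝ ∞ χ) (hc : HasCompactSupport χ) :
    Continuous fun t =>
      (StraightMetricGraph.kinetic (timeSlice hs hc t)).toLp 2 (volume : Measure ℝ) := by
  have h := (continuous_timeSlice
    (contDiff_fderiv_apply_const (contDiff_fderiv_apply_const hs (0, 1)) (0, 1))
    ((hc.fderiv_apply ℝ (0, 1)).fderiv_apply ℝ (0, 1))).const_smul (-(1 / 2) : ℂ)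
  refine h.congr fun t => ?_
  rw [kinetic_timeSlice]
  exact (map_smul (SchwartzMap.toLpCLM ℂ ℂ 2 (volume : Measure ℝ)) _ _).symm

end Slices

/-! ### Unitary groups -/

namespace IsUnitaryGroupOf

variable {E : Type*} [NormedAddCommGroup E] [InnerProductSpace ℂ E] {A : E →ₗ.[ℂ] E}
  {U : ℝ → E ≃ₗᵢ[ℂ] E}

/-- The group commutes with itself, so each $U_t$ carries the derivative at $0$ of the orbit of
$\psi$ to that of $U_t\psi$. -/
theorem mem_graph (hU : IsUnitaryGroupOf A U) {ψ η : E} (h : (ψ, η) ∈ A.graph) (t : ℝ) :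
    (U t ψ, U t η) ∈ A.graph := by
  rw [hU.generator] at h ⊢
  have h1 := ((U t).toContinuousLinearEquiv : E →L[ℂ] E).hasFDerivAt.restrictScalars ℝ
    |>.comp_hasDerivAt (0 : ℝ) h
  refine (h1.congr_deriv ?_).congr_of_eventuallyEq (Eventually.of_forall fun s => ?_)
  · simp
  · change U s (U t ψ) = U t (U s ψ)
    rw [← hU.map_add, ← hU.map_add, add_comm]

theorem hasDerivAt (hU : IsUnitaryGroupOf A U) {ψ η : E} (h : (ψ, η) ∈ A.graph) (t : ℝ) :
    HasDerivAt (fun s => U s ψ) (-(Complex.I • U t η)) t := by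
  have h1 := (hU.generator _ _).1 (hU.mem_graph h t)
  rw [← sub_self t] at h1
  have h2 := HasDerivAt.comp_sub_const t t h1
  refine h2.congr_of_eventuallyEq (Eventually.of_forall fun s => ?_)
  change U s ψ = U (s - t) (U t ψ)
  rw [← hU.map_add, sub_add_cancel]

/-- Symmetry of the generator comes from unitarity alone, by differentiating the constant $\langle
U_t\psi,U_t\psi'\rangle$ at $0$. -/
theorem inner_symm (hU : IsUnitaryGroupOf A U) {ψ η ψ' η' : E} (h : (ψ, η) ∈ A.graph)
    (h' : (ψ', η') ∈ A.graph) : inner ℂ ψ η' = inner ℂ η ψ' := by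
  have h1 := ((hU.generator _ _).1 h).inner ℂ ((hU.generator _ _).1 h')
  have h2 : (fun t => inner ℂ (U t ψ) (U t ψ')) = fun _ => inner ℂ ψ ψ' :=
    funext fun t => (U t).inner_map_map ψ ψ'
  rw [h2] at h1
  have h3 := h1.unique (hasDerivAt_const (0 : ℝ) _)
  rw [hU.map_zero, hU.map_zero, inner_neg_right, inner_neg_left, inner_smul_right,
    inner_smul_left, Complex.conj_I] at h3
  linear_combination Complex.I * h3 + (inner ℂ ψ η' - inner ℂ η ψ') * Complex.I_mul_I

end IsUnitaryGroupOf

/-! ### Approximate Schrödinger equation for the components and passage to the limit -/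

namespace StraightMetricGraph

variable {J : Type*} [Finite J] (Γ : StraightMetricGraph J)

/-- Membership in the operator domain makes the evolved state differentiable in time, so the weak
equation can be derived by an honest time derivative. -/
theorem exists_initialState_mem {j₀ : J} {f : ℝ → ℂ} (hf : Γ.IsTestFunctionOn j₀ f) (n : ℕ) {ε : ℝ}
    (hε : 0 < ε) :
    ∃ η, (Γ.initialState hf n hε, η) ∈ (Γ.shiftedHamiltonian n ε).graph := by
  obtain ⟨e, he, -⟩ := Γ.exists_mem_shiftedHamiltonian j₀ n hε
    (hf.hasCompactSupport.toSchwartzMap hf.contDiff) fun x hx => by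
      have := hf.tsupport_subset (subset_tsupport f hx)
      exact ⟨this.1.le, this.2.le⟩
  rw [Γ.initialState_eq_lift]
  exact ⟨_, he⟩

theorem norm_evolvedState {j₀ : J} {f : ℝ → ℂ} (hf : Γ.IsTestFunctionOn j₀ f) (n : ℕ) {ε : ℝ}
    (hε : 0 < ε) (t : ℝ) : ‖Γ.evolvedState hf n hε t‖ ≤ Real.sqrt (∫ y, transverseMode n 1 y ^ 2) *
      ‖(hf.hasCompactSupport.toSchwartzMap hf.contDiff).toLp 2 (volume : Measure ℝ)‖ := by
  rw [evolvedState, LinearIsometryEquiv.norm_map, initialState_eq_lift]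
  exact (ContinuousLinearMap.le_opNorm _ _).trans
    (mul_le_mul_of_nonneg_right (Γ.norm_lift_le_uniform j₀ n hε) (norm_nonneg _))

theorem continuous_component {j₀ : J} {f : ℝ → ℂ} (hf : Γ.IsTestFunctionOn j₀ f) (n : ℕ) (j : J)
    {ε : ℝ} (hε : 0 < ε) : Continuous fun t => Γ.component hf n j n hε t := by
  simp only [component, projection_eq_adjoint, evolvedState]
  exact (ContinuousLinearMap.continuous _).comp
    ((Γ.isUnitaryGroupOf_expNegI n hε).continuous _)

theorem inner_component {j₀ : J} {f : ℝ → ℂ} (hf : Γ.IsTestFunctionOn j₀ f) (n : ℕ) (j : J)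
    {ε : ℝ} (hε : 0 < ε) (t : ℝ) (θ : L2Line) : inner ℂ θ (Γ.component hf n j n hε t) =
      inner ℂ (Γ.lift j n hε θ) (Γ.evolvedState hf n hε t) := by
  rw [component, projection_eq_adjoint, ContinuousLinearMap.adjoint_inner_right]

theorem norm_component_le {j₀ : J} {f : ℝ → ℂ} (hf : Γ.IsTestFunctionOn j₀ f) (n : ℕ) :
    ∃ C : ℝ, 0 ≤ C ∧ ∀ (j : J) {ε : ℝ} (hε : 0 < ε) (t : ℝ), ‖Γ.component hf n j n hε t‖ ≤ C := by
  refine ⟨Real.sqrt (∫ y, transverseMode n 1 y ^ 2) * (Real.sqrt (∫ y, transverseMode n 1 y ^ 2) *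
    ‖(hf.hasCompactSupport.toSchwartzMap hf.contDiff).toLp 2 (volume : Measure ℝ)‖),
    by positivity, fun j ε hε t => ?_⟩
  rw [component, projection_eq_adjoint]
  refine (ContinuousLinearMap.le_opNorm _ _).trans ?_
  rw [LinearIsometryEquiv.norm_map]
  exact mul_le_mul (Γ.norm_lift_le_uniform j n hε) (Γ.norm_evolvedState hf n hε t)
    (norm_nonneg _) (Real.sqrt_nonneg _)

/-- The weak Schrödinger equation holds for the transverse components up to an error of
order `ε`. -/
theorem norm_integral_component_le {j₀ : J} {f : ℝ → ℂ} (hf : Γ.IsTestFunctionOn j₀ f) (n : ℕ)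
    {T : ℝ} (hT : 0 < T) (j : J) {χ : ℝ × ℝ → ℂ} (hs : ContDiff ℝ ∞ χ) (hc : HasCompactSupport χ)
    (hsupp : tsupport χ ⊆ {z | 0 < z.1 ∧ z.1 < T ∧ 0 < z.2 ∧ (z.2 : EReal) < Γ.len j}) :
    ∃ C : ℝ, ∀ (ε : ℝ) (hε : 0 < ε),
      ‖(∫ t in Ioo 0 T, inner ℂ ((timeSlice (contDiff_fderiv_apply_const hs (1, 0))
          (hc.fderiv_apply ℝ (1, 0)) t).toLp 2 volume) (Γ.component hf n j n hε t)) -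
        Complex.I * ∫ t in Ioo 0 T, inner ℂ ((kinetic (timeSlice hs hc t)).toLp 2 volume)
          (Γ.component hf n j n hε t)‖ ≤ C * ε := by
  set K : Set ℝ := Prod.snd '' tsupport χ with hK
  have hKc : IsCompact K := hc.isCompact.image continuous_snd
  have hKl : K ⊆ {x | 0 < x ∧ (x : EReal) < Γ.len j} := by
    rintro _ ⟨z, hz, rfl⟩
    exact (hsupp hz).2.2
  have haK : ∀ t x, timeSlice hs hc t x ≠ 0 → x ∈ K := fun t x hx =>
    ⟨(t, x), subset_tsupport χ hx, rfl⟩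
  have hzero : ∀ t, t ∉ Ioo 0 T → timeSlice hs hc t = 0 := fun t ht => by
    ext x
    refine image_eq_zero_of_notMem_tsupport (f := χ) (x := (t, x)) fun h => ht ?_
    exact ⟨(hsupp h).1, (hsupp h).2.1⟩
  obtain ⟨C₁, hC₁, herr⟩ := Γ.exists_mem_shiftedHamiltonian_norm_le j n hKc hKl
  set a : ℝ → L2Line := fun t => (timeSlice hs hc t).toLp 2 volume with ha
  set a' : ℝ → L2Line := fun t => (timeSlice (contDiff_fderiv_apply_const hs (1, 0))
    (hc.fderiv_apply ℝ (1, 0)) t).toLp 2 volume with ha'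
  set b : ℝ → L2Line := fun t => (kinetic (timeSlice hs hc t)).toLp 2 volume with hb
  have hac : Continuous a := continuous_timeSlice hs hc
  have hac' : Continuous a' := continuous_timeSlice _ _
  have hbc : Continuous b := continuous_kinetic_timeSlice hs hc
  obtain ⟨B, hB⟩ := (isCompact_Icc (a := (0 : ℝ)) (b := T)).exists_bound_of_continuousOn
    hac.continuousOn
  set N : ℝ := Real.sqrt (∫ y, transverseMode n 1 y ^ 2) *
      ‖(hf.hasCompactSupport.toSchwartzMap hf.contDiff).toLp 2 (volume : Measure ℝ)‖ with hN
  refine ⟨C₁ * B * N * T, fun ε hε => ?_⟩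
  have hU := Γ.isUnitaryGroupOf_expNegI n hε
  set U := expNegI (Γ.shiftedHamiltonian n ε) with hUdef
  set ψ₀ := Γ.initialState hf n hε with hψ₀
  obtain ⟨η₀, hη₀⟩ := Γ.exists_initialState_mem hf n hε
  set L := Γ.lift j n hε with hL
  have hUψ : ∀ t, Γ.evolvedState hf n hε t = U t ψ₀ := fun t => rfl
  -- This is the time derivative of $\langle L\,a(t),U_t\psi_0\rangle$; it integrates to zero
  -- because the test function vanishes at both ends of $[0,T]$.
  set d : ℝ → ℂ := fun t => inner ℂ (L (a t)) (-(Complex.I • U t η₀)) +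
    inner ℂ (L (a' t)) (U t ψ₀) with hd
  have hdc : Continuous d := by
    have h1 := hU.continuous η₀
    have h2 := hU.continuous ψ₀
    exact ((L.continuous.comp hac).inner (h1.const_smul Complex.I).neg).add
      ((L.continuous.comp hac').inner h2)
  have hderiv : ∀ t, HasDerivAt (fun s => inner ℂ (L (a s)) (U s ψ₀)) (d t) t := fun t =>
    ((L.hasFDerivAt.restrictScalars ℝ).comp_hasDerivAt t (hasDerivAt_timeSlice hs hc t)).inner ℂ
      (hU.hasDerivAt hη₀ t)
  have hint : ∫ t in Ioo 0 T, d t = 0 := by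
    rw [← integral_Ioc_eq_integral_Ioo, ← intervalIntegral.integral_of_le hT.le,
      intervalIntegral.integral_eq_sub_of_hasDerivAt (fun t _ => hderiv t)
        (hdc.intervalIntegrable _ _)]
    have h0 : a 0 = 0 := by
      rw [ha]
      simp only
      rw [hzero 0 (by simp)]
      exact map_zero (SchwartzMap.toLpCLM ℂ ℂ 2 (volume : Measure ℝ))
    have hT' : a T = 0 := by
      rw [ha]
      simp only
      rw [hzero T (by simp)]
      exact map_zero (SchwartzMap.toLpCLM ℂ ℂ 2 (volume : Measure ℝ))
    rw [h0, hT', map_zero, inner_zero_left, inner_zero_left, sub_zero]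
  have hcomp := Γ.continuous_component hf n j hε
  have hi : ∀ g : ℝ → ℂ, Continuous g → Integrable g (volume.restrict (Ioo 0 T)) := fun g hg =>
    (hg.integrableOn_Icc (a := 0) (b := T)).mono_set Ioo_subset_Icc_self
  have e : (∫ t in Ioo 0 T, inner ℂ (a' t) (Γ.component hf n j n hε t)) -
      Complex.I * ∫ t in Ioo 0 T, inner ℂ (b t) (Γ.component hf n j n hε t) =
      ∫ t in Ioo 0 T, (inner ℂ (a' t) (Γ.component hf n j n hε t) -
        Complex.I * inner ℂ (b t) (Γ.component hf n j n hε t) - d t) := by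
    rw [integral_sub, integral_sub, hint, sub_zero, integral_const_mul]
    · exact hi _ (hac'.inner hcomp)
    · exact (hi _ (hbc.inner hcomp)).const_mul _
    · exact (hi _ (hac'.inner hcomp)).sub ((hi _ (hbc.inner hcomp)).const_mul _)
    · exact hi _ hdc
  rw [e]
  have hbound : ∀ t ∈ Ioo 0 T, ‖inner ℂ (a' t) (Γ.component hf n j n hε t) -
        Complex.I * inner ℂ (b t) (Γ.component hf n j n hε t) - d t‖ ≤ C₁ * ε * B * N := by
    intro t ht
    obtain ⟨r, hr, hrn⟩ := herr ε hε (timeSlice hs hc t) (haK t)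
    -- Symmetry moves $\widetilde H$ from the evolved state to the lifted slice, where it acts as
    -- the longitudinal kinetic energy plus the small remainder `r`. The pairing with `r` is all
    -- that is left of the integrand.
    have h1 := hU.inner_symm hr (hU.mem_graph hη₀ t)
    have h2 : inner ℂ (a' t) (Γ.component hf n j n hε t) -
        Complex.I * inner ℂ (b t) (Γ.component hf n j n hε t) - d t =
        Complex.I * inner ℂ r (U t ψ₀) := by
      rw [inner_component, inner_component, hUψ, hd]
      simp only [inner_neg_right, inner_smul_right]
      rw [inner_add_left] at h1
      linear_combination Complex.I * h1
    rw [h2, norm_mul, Complex.norm_I, one_mul]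
    refine (norm_inner_le_norm _ _).trans ?_
    have h3 : ‖U t ψ₀‖ ≤ N := Γ.norm_evolvedState hf n hε t
    have h4 : ‖r‖ ≤ C₁ * ε * B :=
      hrn.trans (mul_le_mul_of_nonneg_left (hB t (Ioo_subset_Icc_self ht)) (by positivity))
    exact mul_le_mul h4 h3 (norm_nonneg _) ((norm_nonneg _).trans h4)
  refine (norm_setIntegral_le_of_norm_le_const (by simp) hbound).trans (le_of_eq ?_)
  simp [Measure.real, hT.le]
  ring

/-- A weak-star limit of the transverse components solves the free Schrödinger equation. -/
theorem solvesFreeSchrodinger_of_weakStarTendsto {j₀ : J} {f : ℝ → ℂ}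
    (hf : Γ.IsTestFunctionOn j₀ f) (n : ℕ) {T : ℝ} (hT : 0 < T) (j : J) {ε : ℕ → ℝ}
    (hε : ∀ k, 0 < ε k) (hlim : Tendsto ε atTop (𝓝 0)) {s : ℝ → L2Line}
    (hs : WeakStarTendsto T (fun k t => Γ.component hf n j n (hε k) t) s) :
    SolvesFreeSchrodinger T (Γ.len j) s := by
  intro φ hφs hφc hφ
  -- The inner product conjugates its first argument, whereas the distributional pairing with `φ` is
  -- bilinear.
  set χ : ℝ × ℝ → ℂ := fun z => conj (φ z) with hχ
  have hχs : ContDiff ℝ ∞ χ := (Complex.conjCLE : ℂ →L[ℝ] ℂ).contDiff.comp hφs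
  have hχc : HasCompactSupport χ := hφc.comp_left (g := conj) (map_zero _)
  have hχt : tsupport χ ⊆ {z | 0 < z.1 ∧ z.1 < T ∧ 0 < z.2 ∧ (z.2 : EReal) < Γ.len j} :=
    (tsupport_comp_subset (g := conj) (map_zero _) φ).trans hφ
  have hi : ∀ g : ℝ → L2Line, Continuous g → Integrable g (volume.restrict (Ioo 0 T)) :=
    fun g hg => (hg.integrableOn_Icc (a := 0) (b := T)).mono_set Ioo_subset_Icc_self
  obtain ⟨C, hC⟩ := Γ.norm_integral_component_le hf n hT j hχs hχc hχt
  set a' : ℝ → L2Line := fun t => (timeSlice (contDiff_fderiv_apply_const hχs (1, 0))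
    (hχc.fderiv_apply ℝ (1, 0)) t).toLp 2 volume with ha'
  set b : ℝ → L2Line := fun t => (kinetic (timeSlice hχs hχc t)).toLp 2 volume with hb
  have h1 := hs.tendsto a' (hi _ (continuous_timeSlice _ _))
  have h2 := hs.tendsto b (hi _ (continuous_kinetic_timeSlice hχs hχc))
  have h3 := h1.sub (h2.const_mul Complex.I)
  -- The same expression converges to this value by weak-* convergence and to $0$ by the
  -- $O(\varepsilon)$ bound.
  have h4 : (∫ t in Ioo 0 T, inner ℂ (a' t) (s t)) -
      Complex.I * ∫ t in Ioo 0 T, inner ℂ (b t) (s t) = 0 := by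
    refine tendsto_nhds_unique h3 (squeeze_zero_norm (fun k => hC (ε k) (hε k)) ?_)
    simpa using hlim.const_mul C
  have hconj : ∀ g : ℝ → ℂ, deriv (fun x => conj (g x)) = fun x => conj (deriv g x) := fun g =>
    deriv.star' (f := g)
  have e1 : ∀ t, ∫ x, s t x * (-(Complex.I * deriv (fun τ => φ (τ, x)) t)) =
      -Complex.I * inner ℂ (a' t) (s t) := fun t => by
    rw [L2.inner_def, ← integral_const_mul]
    refine integral_congr_ae ?_
    filter_upwards [(timeSlice (contDiff_fderiv_apply_const hχs (1, 0))
      (hχc.fderiv_apply ℝ (1, 0)) t).coeFn_toLp 2 (volume : Measure ℝ)] with x hx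
    have h5 : fderiv ℝ χ (t, x) (1, 0) = conj (deriv (fun τ => φ (τ, x)) t) := by
      rw [← (hasDerivAt_left hχs t x).deriv, hχ, hconj]
    rw [hx, timeSlice_apply, h5, RCLike.inner_apply, Complex.conj_conj]
    ring
  have e2 : ∀ t, ∫ x, s t x * (-(1 / 2 : ℂ) * iteratedDeriv 2 (fun ξ => φ (t, ξ)) x) =
      inner ℂ (b t) (s t) := fun t => by
    rw [L2.inner_def]
    refine integral_congr_ae ?_
    filter_upwards [(kinetic (timeSlice hχs hχc t)).coeFn_toLp 2 (volume : Measure ℝ)] with x hx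
    have h5 : kinetic (timeSlice hχs hχc t) x =
        conj (-(1 / 2 : ℂ) * iteratedDeriv 2 (fun ξ => φ (t, ξ)) x) := by
      have h6 : kinetic (timeSlice hχs hχc t) x =
          (-(1 / 2) : ℂ) * deriv (deriv fun ξ => conj (φ (t, ξ))) x := rfl
      rw [h6, hconj, hconj, iteratedDeriv_succ, iteratedDeriv_one, map_mul]
      simp [Complex.conj_ofNat]
    rw [hx, h5, RCLike.inner_apply, Complex.conj_conj]
  simp_rw [e1, e2]
  rw [integral_const_mul]
  linear_combination (-Complex.I) * h4 - (∫ t in Ioo 0 T, inner ℂ (b t) (s t)) * Complex.I_mul_I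

end StraightMetricGraph

theorem mainTheorem2 {J : Type*} [Finite J] (Γ : StraightMetricGraph J)
    (j₀ : J) (n : ℕ) (f : ℝ → ℂ) (hf : Γ.IsTestFunctionOn j₀ f) (T : ℝ) (hT : 0 < T) :
    (∀ ε : ℝ, 0 < ε →
      IsUnitaryGroupOf (Γ.shiftedHamiltonian n ε) (expNegI (Γ.shiftedHamiltonian n ε))) ∧
    ∀ (ε : ℕ → ℝ) (hε : ∀ k, 0 < ε k), Tendsto ε atTop (𝓝 0) →
      ∃ κ : ℕ → ℕ, StrictMono κ ∧
        ∀ j : J, ∃ s : ℝ → L2Line,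
          WeakStarTendsto T (fun k t => Γ.component hf n j n (hε (κ k)) t) s ∧
          SolvesFreeSchrodinger T (Γ.len j) s := by
  refine ⟨fun ε hε => Γ.isUnitaryGroupOf_expNegI n hε, fun ε hε hlim => ?_⟩
  obtain ⟨C, hC0, hC⟩ := Γ.norm_component_le hf n
  obtain ⟨κ, hκ, hs⟩ := exists_weakStarTendsto T (fun j k t => Γ.component hf n j n (hε k) t)
    (fun j k => Γ.continuous_component hf n j (hε k)) C hC0 (fun j k t => hC j (hε k) t)
  refine ⟨κ, hκ, fun j => ?_⟩
  obtain ⟨s, hs⟩ := hs j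
  exact ⟨s, hs, Γ.solvesFreeSchrodinger_of_weakStarTendsto hf n hT j (fun k => hε (κ k))
    (hlim.comp hκ.tendsto_atTop) hs⟩
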